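/- Setting. An $N$-mode bosonic system has Hilbert space $L^2(\mathbb R^N)$ with quadratures $R=(q_1,\dots,q_N,p_1,\dots,p_N)$, $[q_k,p_l]=i\delta_{kl}$, and Hamiltonian $H=\tfrac12\sum_{i=1}^N(q_i^2+p_i^2)$. A (displacement-free) pure Gaussian state is $\rho=|\psi\rangle\langle\psi|$ with $\langle\psi,e^{i\xi\cdot R}\psi\rangle=e^{-\frac14\xi^{T}\Sigma\xi}$ for all $\xi\in\mathbb R^{2N}$ and some real symmetric matrix $\Sigma$ (the covariance matrix). A Gaussian unitary is a unitary $U$ with $U^\dagger RU=SR+d$ for a symplectic matrix $S$ and a vector $d$. A $k$-partition $\mathcal A_1|\cdots|\mathcal A_k$ splits the $N$ modes into $k$ non-empty disjoint sets. The $k$-local ergotropic gap is the difference of the global and the $k$-local Gaussian ergotropies, $$\delta^{\mathcal A_1|\cdots|\mathcal A_k}(\rho)=\Big[\operatorname{Tr}(\rho H)-\min_{U}\operatorname{Tr}(U\rho U^\dagger H)\Big]-\Big[\operatorname{Tr}(\rho H)-\min_{U=\otimes_jU_{\mathcal A_j}}\operatorname{Tr}(U\rho U^\dagger H)\Big],$$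 where the first minimum is over all Gaussian unitaries and the second over all tensor products of Gaussian unitaries $U_{\mathcal A_j}$ on the modes in $\mathcal A_j$. The $k$-ergotropic score $\Delta^k(\rho)$ is the minimum of $\delta^{\mathcal A_1|\cdots|\mathcal A_k}(\rho)$ over all $k$-partitions of the modes. For a composite of an $N$-mode and an $N'$-mode system, a pooled $k$-partition is one of the form $\tilde{\mathcal A}_1|\cdots|\tilde{\mathcal A}_k$ with $\tilde{\mathcal A}_j=\mathcal A_j\cup\mathcal A'_j$, where $\mathcal A_1|\cdots|\mathcal A_k$ and $\mathcal A'_1|\cdots|\mathcal A'_k$ are $k$-partitions of the modes of the first and of the second system (each of the $k$ parties holds modes of both systems). Let $\tilde\Delta^k$ denote the minimum of the $k$-local ergotropic gap over all pooled $k$-partitions. Corollary. Let $k\ge1$. (i) Faithfulness. For every pure $N$-mode Gaussian state $\rho$ with $N\ge k$: $\Delta^k(\rho)=0$ if and only if there is a $k$-partition $\mathcal A_1|\cdots|\mathcal A_k$ of the modes across which $\rho$ is a product state, $\rho=\bigotimes_{j=1}^k\rho_{\mathcal A_j}$. (ii) Additivity. For all pure Gaussian states $\rho$ of $N\ge k$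 modes and $\rho'$ of $N'\ge k$ modes, and all $k$-partitions of their modes, $$\delta^{\tilde{\mathcal A}_1|\cdots|\tilde{\mathcal A}_k}(\rho\otimes\rho')=\delta^{\mathcal A_1|\cdots|\mathcal A_k}(\rho)+\delta^{\mathcal A'_1|\cdots|\mathcal A'_k}(\rho'),\qquad \tilde{\mathcal A}_j=\mathcal A_j\cup\mathcal A'_j,$$ and consequently the score of the composite is additive, $$\tilde\Delta^k(\rho\otimes\rho')=\Delta^k(\rho)+\Delta^k(\rho').$$ For the score over all $k$-partitions of the $N+N'$ modes one has $\Delta^k(\rho\otimes\rho')\le\Delta^k(\rho)+\Delta^k(\rho')$. -/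

import Mathlib

open MeasureTheory Matrix
open scoped FourierTransform ENNReal

noncomputable section

/-- The configuration space `ℝ^ι` of a system of bosonic modes labelled by `ι`. -/
abbrev Config (ι : Type) : Type := EuclideanSpace ℝ ι

/-- The Hilbert space `L²(ℝ^ι)` of the modes labelled by `ι` (Schrödinger representation:
`q i` is multiplication by `x i` and `p i = -i ∂/∂(x i)`, so that `[q k, p l] = i δ_{kl}`). -/
abbrev ModeSpace (ι : Type) [Fintype ι] : Type := Lp ℂ 2 (volume : Measure (Config ι))

section Modes

variable {ι : Type} [Fintype ι]

/-- The wave function of `exp (i ∑ (ξ (inl i) q_i + ξ (inr i) p_i)) ψ`. -/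
def weylFun (ξ : ι ⊕ ι → ℝ) (ψ : Config ι → ℂ) (x : Config ι) : ℂ :=
  Complex.exp (Complex.I *
      (((∑ i, ξ (Sum.inl i) * x i) + (1 / 2) * ∑ i, ξ (Sum.inl i) * ξ (Sum.inr i) : ℝ) : ℂ)) *
    ψ (x + WithLp.toLp 2 (fun i => ξ (Sum.inr i)))

theorem memLp_weylFun (ξ : ι ⊕ ι → ℝ) (ψ : ModeSpace ι) :
    MemLp (weylFun ξ ψ) 2 (volume : Measure (Config ι)) := by
  have h1 : MemLp (fun x : Config ι => ψ (x + WithLp.toLp 2 (fun i => ξ (Sum.inr i)))) 2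
      (volume : Measure (Config ι)) :=
    (Lp.memLp ψ).comp_measurePreserving (measurePreserving_add_right volume _)
  refine MemLp.of_le h1 ?_ (Filter.Eventually.of_forall fun x => ?_)
  · refine AEStronglyMeasurable.mul (Continuous.aestronglyMeasurable ?_) h1.aestronglyMeasurable
    fun_prop
  · rw [weylFun, norm_mul, mul_comm Complex.I, Complex.norm_exp_ofReal_mul_I, one_mul]

/-- The Weyl operator `exp (i ξ · R)`, with `R = (q, p)` the vector of quadrature operators. -/
def weyl (ξ : ι ⊕ ι → ℝ) (ψ : ModeSpace ι) : ModeSpace ι :=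
  (memLp_weylFun ξ ψ).toLp (weylFun ξ ψ)

/-- `ψ` is the state vector of a displacement-free pure Gaussian state: its characteristic
function is that of a centred Gaussian with covariance matrix `V`, normalised by
`V k l = ⟨R k R l + R l R k⟩` (so that the vacuum has `V = 1`).
At `ξ = 0` the condition says that `ψ` is a unit vector. -/
def IsPureGaussian (ψ : ModeSpace ι) : Prop :=
  ∃ V : Matrix (ι ⊕ ι) (ι ⊕ ι) ℝ, V.IsSymm ∧
    ∀ ξ : ι ⊕ ι → ℝ,
      inner ℂ ψ (weyl ξ ψ) = ((Real.exp (-(1 / 4) * (ξ ⬝ᵥ (V *ᵥ ξ))) : ℝ) : ℂ)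

/-- The mean energy `Tr (|ψ⟩⟨ψ| H)` for the harmonic Hamiltonian `H = ½ ∑ (q_i² + p_i²)`,
as a quadratic form (`∞` outside the form domain of `H`). The momentum part is read off the
Fourier transform, under which `p_i` is multiplication by `2 π k_i`. -/
def energy (ψ : ModeSpace ι) : ℝ≥0∞ :=
  ∑ i, ((∫⁻ x : Config ι, ENNReal.ofReal ((1 / 2) * (x i) ^ 2 * ‖ψ x‖ ^ 2)) +
    ∫⁻ k : Config ι,
      ENNReal.ofReal ((1 / 2) * (2 * Real.pi * k i) ^ 2 * ‖(𝓕 ψ : ModeSpace ι) k‖ ^ 2))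

/-- `U` is a Gaussian unitary: in the Heisenberg picture it acts on the quadratures by an affine
symplectic map `U† R U = S R + d`, that is, `U† exp(i ξ·R) U = exp(i ξ·d) exp(i (Sᵀ ξ)·R)`. -/
def IsGaussianUnitary [DecidableEq ι] (U : ModeSpace ι ≃ₗᵢ[ℂ] ModeSpace ι) : Prop :=
  ∃ S ∈ Matrix.symplecticGroup ι ℝ, ∃ d : ι ⊕ ι → ℝ, ∀ (ξ : ι ⊕ ι → ℝ) (φ : ModeSpace ι),
    weyl ξ (U φ) =
      Complex.exp (Complex.I * ((ξ ⬝ᵥ d : ℝ) : ℂ)) • U (weyl (Sᵀ *ᵥ ξ) φ)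

/-- The modes that the labelling `P` assigns to the part `j`. -/
abbrev ModesOf {k : ℕ} (P : ι → Fin k) (j : Fin k) : Type := {i : ι // P i = j}

/-- The `k`-partitions of the set of modes: labellings by `Fin k` that leave no part empty. -/
def kPartitions (ι : Type) (k : ℕ) : Set (ι → Fin k) := {P | Function.Surjective P}

/-- `Ψ = ⨂ j, φ j` with respect to the splitting of the modes given by `P`. -/
def IsProductOf {k : ℕ} (P : ι → Fin k) (φ : (j : Fin k) → ModeSpace (ModesOf P j))
    (Ψ : ModeSpace ι) : Prop :=
  (Ψ : Config ι → ℂ) =ᵐ[volume]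
    fun x => ∏ j, φ j (WithLp.toLp 2 (fun i : ModesOf P j => x i.1))

/-- The pure state `ψ` is a product state across the partition `P`. -/
def IsProductAcross {k : ℕ} (P : ι → Fin k) (ψ : ModeSpace ι) : Prop :=
  ∃ φ : (j : Fin k) → ModeSpace (ModesOf P j), (∀ j, ‖φ j‖ = 1) ∧ IsProductOf P φ ψ

/-- `U = ⨂ j, U_j` where `U_j` is a Gaussian unitary on the modes of the part `j` of `P`. -/
def IsLocalGaussianUnitary [DecidableEq ι] {k : ℕ} (P : ι → Fin k)
    (U : ModeSpace ι ≃ₗᵢ[ℂ] ModeSpace ι) : Prop :=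
  ∃ u : (j : Fin k) → (ModeSpace (ModesOf P j) ≃ₗᵢ[ℂ] ModeSpace (ModesOf P j)),
    (∀ j, IsGaussianUnitary (u j)) ∧
    ∀ φ : (j : Fin k) → ModeSpace (ModesOf P j),
      ∃ Ψ : ModeSpace ι, IsProductOf P φ Ψ ∧ IsProductOf P (fun j => u j (φ j)) (U Ψ)

/-- Global Gaussian ergotropy: the energy minus the least energy under Gaussian unitaries. -/
def globalErgotropy [DecidableEq ι] (ψ : ModeSpace ι) : ℝ :=
  (energy ψ).toReal -
    (⨅ (U : ModeSpace ι ≃ₗᵢ[ℂ] ModeSpace ι) (_ : IsGaussianUnitary U), energy (U ψ)).toReal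

/-- `k`-local Gaussian ergotropy with respect to the partition `P`. -/
def localErgotropy [DecidableEq ι] {k : ℕ} (P : ι → Fin k) (ψ : ModeSpace ι) : ℝ :=
  (energy ψ).toReal -
    (⨅ (U : ModeSpace ι ≃ₗᵢ[ℂ] ModeSpace ι) (_ : IsLocalGaussianUnitary P U),
      energy (U ψ)).toReal

/-- The `k`-local ergotropic gap with respect to the partition `P`. -/
def ergotropicGap [DecidableEq ι] {k : ℕ} (P : ι → Fin k) (ψ : ModeSpace ι) : ℝ :=
  globalErgotropy ψ - localErgotropy P ψ

/-- The least `k`-local ergotropic gap over a (finite) set of admissible partitions. -/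
def minGap [DecidableEq ι] {k : ℕ} (C : Set (ι → Fin k)) (ψ : ModeSpace ι) : ℝ :=
  sInf ((fun P => ergotropicGap P ψ) '' C)

/-- The `k`-ergotropic score `Δ^k`: the least gap over all `k`-partitions of the modes. -/
def ergotropicScore [DecidableEq ι] (k : ℕ) (ψ : ModeSpace ι) : ℝ :=
  minGap (kPartitions ι k) ψ

end Modes

section Composite

variable {ι ι' : Type} [Fintype ι] [Fintype ι']

/-- The wave function of `ψ ⊗ ψ'`. -/
def tensorFun (ψ : Config ι → ℂ) (ψ' : Config ι' → ℂ) (x : Config (ι ⊕ ι')) : ℂ :=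
  ψ (WithLp.toLp 2 (fun i => x (Sum.inl i))) * ψ' (WithLp.toLp 2 (fun i => x (Sum.inr i)))

theorem measurePreserving_split :
    MeasurePreserving (fun x : Config (ι ⊕ ι') =>
      ((WithLp.toLp 2 (fun i => x (Sum.inl i)) : Config ι),
        (WithLp.toLp 2 (fun i => x (Sum.inr i)) : Config ι')))
      volume ((volume : Measure (Config ι)).prod (volume : Measure (Config ι'))) := by
  have h1 := PiLp.volume_preserving_ofLp (ι ⊕ ι')
  have h2 := volume_measurePreserving_sumPiEquivProdPi (fun _ : ι ⊕ ι' => ℝ)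
  have h3 := (PiLp.volume_preserving_toLp ι).prod (PiLp.volume_preserving_toLp ι')
  exact h3.comp (h2.comp h1)

theorem memLp_tensorFun (ψ : ModeSpace ι) (ψ' : ModeSpace ι') :
    MemLp (tensorFun ψ ψ') 2 (volume : Measure (Config (ι ⊕ ι'))) := by
  have hψ := Lp.memLp ψ
  have hψ' := Lp.memLp ψ'
  have key : MemLp (fun z : Config ι × Config ι' => ψ z.1 * ψ' z.2) 2
      ((volume : Measure (Config ι)).prod (volume : Measure (Config ι'))) := by
    refine ⟨hψ.1.comp_fst.mul hψ'.1.comp_snd, ?_⟩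
    have a := (eLpNorm_lt_top_iff_lintegral_rpow_enorm_lt_top (by norm_num) (by norm_num)).1 hψ.2
    have b := (eLpNorm_lt_top_iff_lintegral_rpow_enorm_lt_top (by norm_num) (by norm_num)).1 hψ'.2
    rw [eLpNorm_lt_top_iff_lintegral_rpow_enorm_lt_top (by norm_num) (by norm_num)]
    have : ∀ z : Config ι × Config ι', ‖ψ z.1 * ψ' z.2‖ₑ ^ (2 : ℝ≥0∞).toReal =
        ‖ψ z.1‖ₑ ^ (2 : ℝ≥0∞).toReal * ‖ψ' z.2‖ₑ ^ (2 : ℝ≥0∞).toReal := fun z => by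
      rw [enorm_mul, ENNReal.mul_rpow_of_nonneg _ _ (by norm_num)]
    simp_rw [this]
    rw [lintegral_prod_mul (hψ.1.enorm.pow_const _) (hψ'.1.enorm.pow_const _)]
    exact ENNReal.mul_lt_top a b
  exact key.comp_measurePreserving measurePreserving_split

/-- The tensor product `ψ ⊗ ψ'`, a state of the modes `ι ⊕ ι'`. -/
def tensor (ψ : ModeSpace ι) (ψ' : ModeSpace ι') : ModeSpace (ι ⊕ ι') :=
  (memLp_tensorFun ψ ψ').toLp (tensorFun ψ ψ')

/-- The `k`-partitions of a composite system obtained by pooling: the part `j` is the union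
`A_j ∪ A'_j`, where `A_1|…|A_k` is a `k`-partition of the modes of the first system and
`A'_1|…|A'_k` is a `k`-partition of the modes of the second one. -/
def pooledPartitions (ι ι' : Type) (k : ℕ) : Set (ι ⊕ ι' → Fin k) :=
  {Q | ∃ P ∈ kPartitions ι k, ∃ P' ∈ kPartitions ι' k, Q = Sum.elim P P'}

/-- The `k`-ergotropic score of a composite system shared by `k` parties, each of which holds
modes of both systems: the least gap over all pooled `k`-partitions. -/
def pooledErgotropicScore [DecidableEq ι] [DecidableEq ι'] (k : ℕ)
    (Ψ : ModeSpace (ι ⊕ ι')) : ℝ :=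
  minGap (pooledPartitions ι ι' k) Ψ

end Composite

end

/-
The argument is matrix analysis. The mean energy of a centred Gaussian state with covariance
matrix `V` is `tr V / 4`, displacements only add energy, and a Gaussian unitary that is local for a
partition turns `V` into `S V Sᵀ` with `S` symplectic and block diagonal. Conversely, every such
`S` has the same `SᵀS` as a product of a linear change of coordinates and a quadratic shear, and
these are implemented explicitly by `ψ ↦ √|det A| e^{iq} ψ(A ·)`. So an ergotropic gap is a quarter
of the difference of two least traces of `S V Sᵀ`, block diagonal minus arbitrary symplectic `S`.

The least trace is attained, by compactness, and `S` attains it if and only if the block diagonal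
part of `S V Sᵀ` commutes with `J`. This first-order condition is inherited by direct sums, which
gives additivity, and for block diagonal `V` it does not distinguish the two minima, so that
product states have gap zero.

For the converse, if the gap vanishes then a block diagonal minimiser is a global one, and so
`W = S V Sᵀ` commutes with `J`. Purity makes `V = T Tᵀ` with `T` symplectic; hence `W` is positive
definite, symplectic and commutes with `J`, which forces `W = 1`. The corresponding local Gaussian
unitary then maps the state to the vacuum, a product state.
-/

noncomputable section

/-! ### Block diagonal matrices -/

section BlockDiagonal

variable {n α R : Type*}

/-- `M` is block diagonal for the partition of the indices into the level sets of the labelling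
`b`. -/
def IsBlockDiagonal [Zero R] (b : n → α) (M : Matrix n n R) : Prop :=
  ∀ ⦃i j⦄, b i ≠ b j → M i j = 0

/-- The block diagonal part of `M`. -/
def pinch [Zero R] [DecidableEq α] (b : n → α) (M : Matrix n n R) : Matrix n n R :=
  of fun i j => if b i = b j then M i j else 0

theorem isBlockDiagonal_one [Zero R] [One R] [DecidableEq n] (b : n → α) :
    IsBlockDiagonal b (1 : Matrix n n R) :=
  fun _ _ h => one_apply_ne (ne_of_apply_ne b h)

theorem isBlockDiagonal_const [Zero R] (a : α) (M : Matrix n n R) :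
    IsBlockDiagonal (fun _ => a) M :=
  fun _ _ h => absurd rfl h

theorem IsBlockDiagonal.transpose [Zero R] {b : n → α} {M : Matrix n n R}
    (hM : IsBlockDiagonal b M) : IsBlockDiagonal b Mᵀ :=
  fun _ _ h => hM h.symm

theorem IsBlockDiagonal.mul [Fintype n] [NonUnitalNonAssocSemiring R] {b : n → α}
    {M N : Matrix n n R} (hM : IsBlockDiagonal b M) (hN : IsBlockDiagonal b N) :
    IsBlockDiagonal b (M * N) := by
  refine fun i j h => Finset.sum_eq_zero fun l _ => ?_
  by_cases hil : b i = b l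
  · simp only [hN (hil ▸ h), mul_zero]
  · simp only [hM hil, zero_mul]

theorem isBlockDiagonal_iff_commute [Fintype n] [DecidableEq n] [DecidableEq α] [Semiring R]
    {b : n → α} {M : Matrix n n R} :
    IsBlockDiagonal b M ↔ ∀ a, Commute M (diagonal fun i => if b i = a then 1 else 0) := by
  simp only [Commute, SemiconjBy, ← Matrix.ext_iff, mul_diagonal, diagonal_mul]
  constructor
  · intro hM a i j
    by_cases h : b i = b j
    · simp only [h, mul_ite, mul_one, mul_zero, ite_mul, one_mul, zero_mul]
    · simp only [hM h, zero_mul, mul_zero]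
  · intro hM i j h
    simpa [h] using hM (b j) i j

theorem IsBlockDiagonal.inv [Fintype n] [DecidableEq n] [CommRing R] {b : n → α}
    {M : Matrix n n R} (hM : IsBlockDiagonal b M) : IsBlockDiagonal b M⁻¹ := by
  classical
  rw [isBlockDiagonal_iff_commute] at hM ⊢
  intro a
  rw [nonsing_inv_eq_ringInverse]
  by_cases h : IsUnit M
  · obtain ⟨u, rfl⟩ := h
    rw [Ring.inverse_unit]
    exact (hM a).units_inv_left
  · rw [Ring.inverse_non_unit _ h]
    exact Commute.zero_left _

theorem isClosed_setOf_isBlockDiagonal [Zero R] [TopologicalSpace R] [T1Space R] (b : n → α) :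
    IsClosed {M : Matrix n n R | IsBlockDiagonal b M} := by
  simp only [IsBlockDiagonal, Set.ofPred_forall]
  exact isClosed_iInter fun i => isClosed_iInter fun j => isClosed_iInter fun _ =>
    isClosed_singleton.preimage (continuous_id.matrix_elem i j)

open scoped MatrixOrder in
theorem IsBlockDiagonal.exists_sqrt [Fintype n] {b : n → α} {W : Matrix n n ℝ}
    (hb : IsBlockDiagonal b W) (hW : W.PosSemidef) :
    ∃ A : Matrix n n ℝ, IsBlockDiagonal b A ∧ Aᵀ = A ∧ A * A = W := by
  classical
  refine ⟨CFC.sqrt W, isBlockDiagonal_iff_commute.2 fun a => ?_, ?_,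
    CFC.sqrt_mul_sqrt_self W hW.nonneg⟩
  · exact (isBlockDiagonal_iff_commute.1 hb a).cfcₙ_nnreal NNReal.sqrt
  · simpa using (nonneg_iff_posSemidef.1 (CFC.sqrt_nonneg W)).isHermitian.eq

section Pinch

variable [DecidableEq α] {b : n → α}

theorem pinch_apply_of_eq [Zero R] (M : Matrix n n R) {i j : n} (h : b i = b j) :
    pinch b M i j = M i j := if_pos h

theorem pinch_apply_of_ne [Zero R] (M : Matrix n n R) {i j : n} (h : b i ≠ b j) :
    pinch b M i j = 0 := if_neg h

theorem IsBlockDiagonal.pinch_eq [Zero R] {M : Matrix n n R} (hM : IsBlockDiagonal b M) :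
    pinch b M = M := by
  ext i j
  by_cases h : b i = b j
  · exact pinch_apply_of_eq M h
  · rw [pinch_apply_of_ne M h, hM h]

theorem transpose_pinch [Zero R] (b : n → α) (M : Matrix n n R) :
    (pinch b M)ᵀ = pinch b Mᵀ := by
  ext i j
  simp only [transpose_apply, pinch, of_apply, eq_comm]

theorem trace_pinch [Fintype n] [AddCommMonoid R] (b : n → α) (M : Matrix n n R) :
    (pinch b M).trace = M.trace :=
  Finset.sum_congr rfl fun _ _ => pinch_apply_of_eq M rfl

theorem IsBlockDiagonal.pinch_mul [Fintype n] [NonUnitalNonAssocSemiring R] (M : Matrix n n R)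
    {N : Matrix n n R} (hN : IsBlockDiagonal b N) : pinch b M * N = pinch b (M * N) := by
  ext i j
  by_cases h : b i = b j
  · rw [pinch_apply_of_eq _ h, mul_apply, mul_apply]
    refine Finset.sum_congr rfl fun l _ => ?_
    by_cases hl : b l = b j
    · rw [pinch_apply_of_eq M (h.trans hl.symm)]
    · rw [hN hl, mul_zero, mul_zero]
  · rw [pinch_apply_of_ne _ h, mul_apply]
    refine Finset.sum_eq_zero fun l _ => ?_
    by_cases hl : b i = b l
    · rw [hN (hl ▸ h), mul_zero]
    · rw [pinch_apply_of_ne M hl, zero_mul]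

theorem trace_mul_mul_transpose [Fintype n] [CommSemiring R] (S V : Matrix n n R) :
    (S * V * Sᵀ).trace = (V * (Sᵀ * S)).trace := by
  rw [Matrix.mul_assoc, trace_mul_comm, Matrix.mul_assoc]

theorem IsBlockDiagonal.trace_mul_pinch_mul_transpose [Fintype n] [CommSemiring R]
    {S : Matrix n n R} (hS : IsBlockDiagonal b S) (V : Matrix n n R) :
    (S * pinch b V * Sᵀ).trace = (S * V * Sᵀ).trace := by
  rw [trace_mul_mul_transpose, trace_mul_mul_transpose, (hS.transpose.mul hS).pinch_mul,
    trace_pinch]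

theorem posSemidef_pinch [Finite n] (b : n → α) {V : Matrix n n ℝ} (hV : V.PosSemidef) :
    (pinch b V).PosSemidef := by
  classical
  have := Fintype.ofFinite n
  let E : Matrix n (Set.range b) ℝ := of fun i a => if b i = a then 1 else 0
  have hE : pinch b V = (E * Eᴴ) ⊙ V := by
    ext i j
    have overlap : ∑ a : Set.range b, E i a * E j a = if b i = b j then 1 else 0 := by
      rw [Finset.sum_eq_single ⟨b i, i, rfl⟩]
      · simp only [E, of_apply, if_true, one_mul, eq_comm]
      · intro a _ ha
        have : b i ≠ a := fun h => ha (Subtype.ext h.symm)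
        simp only [E, of_apply, if_neg this, zero_mul]
      · exact fun h => absurd (Finset.mem_univ _) h
    simp only [hadamard_apply, mul_apply, conjTranspose_apply, star_trivial, overlap, pinch,
      of_apply, ite_mul, one_mul, zero_mul]
  rw [hE]
  exact (posSemidef_self_mul_conjTranspose E).hadamard hV

/-- Polarisation within the blocks. -/
theorem transpose_pinch_eq_neg [Fintype n] [Ring R] {M : Matrix n n R}
    (hM : ∀ (a : α) (v : n → R), (∀ i, b i ≠ a → v i = 0) → v ⬝ᵥ M *ᵥ v = 0) :
    (pinch b M)ᵀ = -pinch b M := by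
  classical
  have entry (i j : n) : Pi.single i 1 ⬝ᵥ M *ᵥ Pi.single j 1 = M i j := by
    rw [mulVec_single_one, single_one_dotProduct, col_apply]
  have supported (i : n) (a : α) (hi : b i = a) (l : n) (hl : b l ≠ a) :
      (Pi.single i 1 : n → R) l = 0 :=
    Pi.single_eq_of_ne (ne_of_apply_ne b (hi ▸ hl)) 1
  ext i j
  rw [transpose_apply, Matrix.neg_apply]
  by_cases h : b i = b j
  · rw [pinch_apply_of_eq M h, pinch_apply_of_eq M h.symm]
    have hi := hM _ _ (supported i (b j) h)
    have hj := hM _ _ (supported j (b j) rfl)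
    have hij := hM _ (Pi.single i 1 + Pi.single j 1) fun l hl => by
      rw [Pi.add_apply, supported i _ h l hl, supported j _ rfl l hl, add_zero]
    rw [entry] at hi hj
    rw [mulVec_add, add_dotProduct, dotProduct_add, dotProduct_add, entry, entry, entry, entry,
      hi, hj, zero_add, add_zero] at hij
    exact eq_neg_of_add_eq_zero_right hij
  · rw [pinch_apply_of_ne M h, pinch_apply_of_ne M (Ne.symm h), neg_zero]

end Pinch

end BlockDiagonal

section TraceConj

variable {m n : Type*} [Fintype m] [Fintype n]

theorem sq_apply_le_trace_mul_transpose (R : Matrix m n ℝ) (i : m) (j : n) :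
    R i j ^ 2 ≤ (R * Rᵀ).trace := by
  have expand : (R * Rᵀ).trace = ∑ i, ∑ j, R i j ^ 2 := by
    simp only [trace, diag, mul_apply, transpose_apply, sq]
  rw [expand]
  exact (Finset.single_le_sum (f := fun j => R i j ^ 2) (fun _ _ => sq_nonneg _)
    (Finset.mem_univ j)).trans (Finset.single_le_sum (f := fun i => ∑ j, R i j ^ 2)
      (fun _ _ => Finset.sum_nonneg fun _ _ => sq_nonneg _) (Finset.mem_univ i))

theorem isCompact_setOf_trace_le {V : Matrix n n ℝ} (hV : V.PosDef) (r : ℝ) :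
    IsCompact {S : Matrix m n ℝ | (S * V * Sᵀ).trace ≤ r} := by
  classical
  obtain ⟨A, -, hAs, hAA⟩ := (isBlockDiagonal_const () V).exists_sqrt hV.posSemidef
  have hA : IsUnit A.det := by
    refine (isUnit_iff_isUnit_det A).1 (isUnit_of_mul_isUnit_left (y := A) ?_)
    exact hAA ▸ hV.isUnit
  have box : IsCompact {R : Matrix m n ℝ | ∀ i j, R i j ∈ Set.Icc (-√r) √r} := by
    simpa only [Set.pi, Set.mem_univ, true_imp_iff] using!
      isCompact_univ_pi fun _ : m => isCompact_univ_pi fun _ : n => isCompact_Icc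
  refine (box.image (f := fun R : Matrix m n ℝ => R * A⁻¹) (by fun_prop)).of_isClosed_subset
    (isClosed_le (by fun_prop) continuous_const) fun S hS => ?_
  refine ⟨S * A, fun i j => abs_le.1 (Real.abs_le_sqrt ?_), ?_⟩
  · refine (sq_apply_le_trace_mul_transpose _ i j).trans (le_of_eq_of_le ?_ hS)
    rw [transpose_mul, hAs, ← hAA]
    simp only [Matrix.mul_assoc]
  · simp only [Matrix.mul_assoc, mul_nonsing_inv _ hA, Matrix.mul_one]

end TraceConj

/-! ### Symplectic matrices -/

section Symplectic

variable {ι R : Type*} [DecidableEq ι] [CommRing R]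

theorem isBlockDiagonal_J {α : Type*} (c : ι → α) : IsBlockDiagonal (Sum.elim c c) (J ι R) := by
  rintro (i | i) (j | j) h
  · rfl
  · exact neg_eq_zero.2 (one_apply_ne (ne_of_apply_ne c h))
  · exact one_apply_ne (ne_of_apply_ne c h)
  · rfl

variable [Fintype ι]

theorem inv_mem_symplecticGroup {S : Matrix (ι ⊕ ι) (ι ⊕ ι) R} (hS : S ∈ symplecticGroup ι R) :
    S⁻¹ ∈ symplecticGroup ι R := by
  simpa only [SymplecticGroup.coe_inv'] using (⟨S, hS⟩ : symplecticGroup ι R)⁻¹.2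

theorem dotProduct_J_mulVec_self (v : ι ⊕ ι → R) : v ⬝ᵥ J ι R *ᵥ v = 0 := by
  obtain ⟨x, y, rfl⟩ : ∃ x y : ι → R, v = Sum.elim x y :=
    ⟨_, _, (Sum.elim_comp_inl_inr v).symm⟩
  simp only [J, fromBlocks_mulVec, Sum.elim_comp_inl, Sum.elim_comp_inr, sumElim_dotProduct_sumElim,
    zero_mulVec, zero_add, add_zero, one_mulVec, neg_mulVec, dotProduct_neg]
  rw [dotProduct_comm, neg_add_cancel]

/-- The symplectic transvection `x ↦ x + t ω(v, x) v`. -/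
def symplecticTransvection (v : ι ⊕ ι → R) (t : R) : Matrix (ι ⊕ ι) (ι ⊕ ι) R :=
  1 + t • vecMulVec v (J ι R *ᵥ v)

theorem symplecticTransvection_mem (v : ι ⊕ ι → R) (t : R) :
    symplecticTransvection v t ∈ symplecticGroup ι R := by
  have mul_J : vecMulVec v (J ι R *ᵥ v) * J ι R = vecMulVec v v := by
    rw [vecMulVec_mul, ← mulVec_transpose, J_transpose, mulVec_mulVec, Matrix.neg_mul, J_squared,
      neg_neg, one_mulVec]
  have J_mul : J ι R * vecMulVec (J ι R *ᵥ v) v = -vecMulVec v v := by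
    rw [mul_vecMulVec, mulVec_mulVec, J_squared, neg_mulVec, one_mulVec, neg_vecMulVec]
  have isotropic : vecMulVec v v * vecMulVec (J ι R *ᵥ v) v = 0 := by
    rw [vecMulVec_mul_vecMulVec, dotProduct_J_mulVec_self, zero_smul, vecMulVec_zero]
  rw [SymplecticGroup.mem_iff, symplecticTransvection]
  simp only [transpose_add, transpose_one, transpose_smul, transpose_vecMulVec, Matrix.add_mul,
    Matrix.mul_add, Matrix.one_mul, Matrix.mul_one, Matrix.smul_mul, Matrix.mul_smul, mul_J, J_mul,
    isotropic, smul_zero, add_zero, smul_neg, add_neg_cancel_right]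

theorem trace_symplecticTransvection_conj {V : Matrix (ι ⊕ ι) (ι ⊕ ι) R} (hV : Vᵀ = V)
    (v : ι ⊕ ι → R) (t : R) :
    (symplecticTransvection v t * V * (symplecticTransvection v t)ᵀ).trace =
      V.trace + 2 * t * (v ⬝ᵥ V *ᵥ J ι R *ᵥ v) +
        t ^ 2 * ((v ⬝ᵥ v) * (J ι R *ᵥ v ⬝ᵥ V *ᵥ J ι R *ᵥ v)) := by
  simp only [symplecticTransvection, transpose_add, transpose_one, transpose_smul,
    transpose_vecMulVec, Matrix.add_mul, Matrix.mul_add, Matrix.one_mul, Matrix.mul_one,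
    Matrix.smul_mul, Matrix.mul_smul, trace_add, trace_smul, vecMulVec_mul, mul_vecMulVec,
    trace_vecMulVec, ← mulVec_transpose, hV, smul_eq_mul]
  set w := J ι R *ᵥ v
  rw [add_mulVec, add_dotProduct, smul_mulVec, vecMulVec_mulVec, smul_dotProduct, op_smul_eq_smul,
    smul_dotProduct, dotProduct_comm (V *ᵥ w), dotProduct_comm (V *ᵥ w)]
  simp only [smul_eq_mul]
  ring

theorem isBlockDiagonal_symplecticTransvection {α : Type*} {c : ι → α} {v : ι ⊕ ι → R} {a : α}
    (hv : ∀ i, Sum.elim c c i ≠ a → v i = 0) (t : R) :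
    IsBlockDiagonal (Sum.elim c c) (symplecticTransvection v t) := by
  have hJv (i : ι ⊕ ι) (hi : Sum.elim c c i ≠ a) : (J ι R *ᵥ v) i = 0 := by
    rw [mulVec, dotProduct]
    refine Finset.sum_eq_zero fun j _ => ?_
    by_cases hij : Sum.elim c c i = Sum.elim c c j
    · rw [hv j (hij ▸ hi), mul_zero]
    · rw [isBlockDiagonal_J c hij, zero_mul]
  intro i j hij
  rw [symplecticTransvection, Matrix.add_apply, Matrix.smul_apply, vecMulVec_apply,
    isBlockDiagonal_one _ hij, zero_add]
  by_cases hi : Sum.elim c c i = a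
  · rw [hJv j (hi ▸ hij.symm), mul_zero, smul_zero]
  · rw [hv i hi, zero_mul, smul_zero]

end Symplectic

/-! ### The least trace under local symplectic congruences -/

/-- Real matrices acting on the phase space of the modes `ι`, with coordinates `(q, p)`. -/
abbrev PhaseMatrix (ι : Type*) : Type _ := Matrix (ι ⊕ ι) (ι ⊕ ι) ℝ

section LeastTrace

variable {ι α : Type*} [Fintype ι] [DecidableEq ι] {c : ι → α} {V S : PhaseMatrix ι}

/-- The symplectic matrices that do not mix modes with different labels. -/
def localSymplecticGroup (c : ι → α) : Submonoid (PhaseMatrix ι) where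
  carrier := {S | S ∈ symplecticGroup ι ℝ ∧ IsBlockDiagonal (Sum.elim c c) S}
  one_mem' := ⟨one_mem _, isBlockDiagonal_one _⟩
  mul_mem' hS hT := ⟨mul_mem hS.1 hT.1, hS.2.mul hT.2⟩

theorem inv_mem_localSymplecticGroup (hS : S ∈ localSymplecticGroup c) :
    S⁻¹ ∈ localSymplecticGroup c :=
  ⟨inv_mem_symplecticGroup hS.1, hS.2.inv⟩

theorem mem_localSymplecticGroup_const {a : α} :
    S ∈ localSymplecticGroup (fun _ : ι => a) ↔ S ∈ symplecticGroup ι ℝ := by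
  refine and_iff_left ?_
  rw [Sum.elim_lam_const_lam_const]
  exact isBlockDiagonal_const a S

/-- The least trace of a congruence of `V` by a symplectic matrix that respects the labels `c`.
It is meant for positive semidefinite `V`, for which the traces are bounded below. -/
def minTrace (c : ι → α) (V : PhaseMatrix ι) : ℝ :=
  ⨅ S : localSymplecticGroup c, ((S : PhaseMatrix ι) * V * (S : PhaseMatrix ι)ᵀ).trace

theorem posSemidef_mul_mul_transpose {m n : Type*} [Finite m] [Fintype n] {V : Matrix n n ℝ}
    (hV : V.PosSemidef) (S : Matrix m n ℝ) : (S * V * Sᵀ).PosSemidef := by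
  simpa only [conjTranspose_eq_transpose_of_trivial] using hV.mul_mul_conjTranspose_same S

theorem minTrace_le (hV : V.PosSemidef) (hS : S ∈ localSymplecticGroup c) :
    minTrace c V ≤ (S * V * Sᵀ).trace := by
  refine ciInf_le (f := fun S : localSymplecticGroup c => (S.1 * V * S.1ᵀ).trace)
    ⟨0, ?_⟩ ⟨S, hS⟩
  rintro _ ⟨T, rfl⟩
  exact (posSemidef_mul_mul_transpose hV T.1).trace_nonneg

theorem exists_trace_eq_minTrace (c : ι → α) (hV : V.PosDef) :
    ∃ S ∈ localSymplecticGroup c, (S * V * Sᵀ).trace = minTrace c V := by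
  let K : Set (PhaseMatrix ι) := {S | (S * V * Sᵀ).trace ≤ V.trace} ∩ localSymplecticGroup c
  have closed : IsClosed (localSymplecticGroup c : Set (PhaseMatrix ι)) := by
    refine IsClosed.inter ?_ (isClosed_setOf_isBlockDiagonal _)
    exact isClosed_eq (f := fun S : PhaseMatrix ι => S * J ι ℝ * Sᵀ) (by fun_prop) continuous_const
  have compact : IsCompact K := (isCompact_setOf_trace_le hV _).inter_right closed
  have one_mem : (1 : PhaseMatrix ι) ∈ K := ⟨by simp, one_mem (localSymplecticGroup c)⟩
  obtain ⟨S, hS, hmin⟩ := compact.exists_isMinOn ⟨1, one_mem⟩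
    (f := fun S => (S * V * Sᵀ).trace) (by fun_prop)
  refine ⟨S, hS.2, le_antisymm (le_ciInf fun T => ?_) (minTrace_le hV.posSemidef hS.2)⟩
  rcases le_total (T.1 * V * T.1ᵀ).trace V.trace with hT | hT
  · exact hmin ⟨hT, T.2⟩
  · exact hS.1.trans hT

/-- The first-order condition for the minimum, tested along symplectic transvections. -/
theorem commute_pinch_J_of_forall_trace_le [DecidableEq α] (hV : Vᵀ = V)
    (hmin : ∀ T ∈ localSymplecticGroup c, V.trace ≤ (T * V * Tᵀ).trace) :
    Commute (pinch (Sum.elim c c) V) (J ι ℝ) := by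
  have isotropic (a : α) (v : ι ⊕ ι → ℝ) (hv : ∀ i, Sum.elim c c i ≠ a → v i = 0) :
      v ⬝ᵥ (V * J ι ℝ) *ᵥ v = 0 := by
    rw [← mulVec_mulVec]
    have nonneg (t : ℝ) : 0 ≤ (v ⬝ᵥ v) * (J ι ℝ *ᵥ v ⬝ᵥ V *ᵥ J ι ℝ *ᵥ v) * (t * t) +
        2 * (v ⬝ᵥ V *ᵥ J ι ℝ *ᵥ v) * t + 0 := by
      have := hmin _ ⟨symplecticTransvection_mem v t, isBlockDiagonal_symplecticTransvection hv t⟩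
      rw [trace_symplecticTransvection_conj hV] at this
      linarith
    have := discrim_le_zero nonneg
    rw [discrim] at this
    nlinarith
  have skew := transpose_pinch_eq_neg isotropic
  rw [← (isBlockDiagonal_J c).pinch_mul, transpose_mul, transpose_pinch, hV, J_transpose,
    Matrix.neg_mul, neg_inj] at skew
  exact skew.symm

/-- Expand `0 ≤ tr ((T + J T J) M (T + J T J)ᵀ)`. -/
theorem trace_le_of_commute_J {M T : PhaseMatrix ι} (hM : M.PosSemidef)
    (hJ : Commute M (J ι ℝ)) (hT : T ∈ symplecticGroup ι ℝ) :
    M.trace ≤ (T * M * Tᵀ).trace := by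
  have hJM : J ι ℝ * M = M * J ι ℝ := hJ.eq.symm
  have hJJ := J_squared ι ℝ
  have hTJT := SymplecticGroup.mem_iff'.1 hT
  have hMs : Mᵀ = M := by simpa only [conjTranspose_eq_transpose_of_trivial] using hM.isHermitian.eq
  have diag_term : (J ι ℝ * T * J ι ℝ * M * (J ι ℝ * T * J ι ℝ)ᵀ).trace = (T * M * Tᵀ).trace := by
    calc (J ι ℝ * T * J ι ℝ * M * (J ι ℝ * T * J ι ℝ)ᵀ).trace
        = (J ι ℝ * (T * (J ι ℝ * M * J ι ℝ) * Tᵀ * J ι ℝ)).trace := by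
          simp only [transpose_mul, J_transpose, Matrix.mul_neg, Matrix.neg_mul, neg_neg,
            Matrix.mul_assoc]
      _ = (T * M * Tᵀ).trace := by
          rw [trace_mul_comm, Matrix.mul_assoc _ (J ι ℝ) (J ι ℝ), hJM, Matrix.mul_assoc M, hJJ]
          simp only [Matrix.mul_neg, Matrix.neg_mul, Matrix.mul_one, neg_neg]
  have cross_term : (T * M * (J ι ℝ * T * J ι ℝ)ᵀ).trace = -M.trace := by
    calc (T * M * (J ι ℝ * T * J ι ℝ)ᵀ).trace
        = (T * (M * J ι ℝ * (Tᵀ * J ι ℝ))).trace := by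
          simp only [transpose_mul, J_transpose, Matrix.mul_neg, Matrix.neg_mul, neg_neg,
            Matrix.mul_assoc]
      _ = -M.trace := by
          rw [trace_mul_comm, Matrix.mul_assoc, hTJT, Matrix.mul_assoc, hJJ, Matrix.mul_neg,
            Matrix.mul_one, trace_neg]
  have cross_term' : (J ι ℝ * T * J ι ℝ * M * Tᵀ).trace = -M.trace := by
    rw [← cross_term, ← trace_transpose]
    simp only [transpose_mul, transpose_transpose, hMs, Matrix.mul_assoc]
  have nonneg := (posSemidef_mul_mul_transpose hM (T + J ι ℝ * T * J ι ℝ)).trace_nonneg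
  simp only [transpose_add, Matrix.add_mul, Matrix.mul_add, trace_add, diag_term, cross_term,
    cross_term'] at nonneg
  linarith

theorem trace_eq_minTrace_of_commute [DecidableEq α] (hV : V.PosSemidef)
    (hS : S ∈ localSymplecticGroup c)
    (hJ : Commute (pinch (Sum.elim c c) (S * V * Sᵀ)) (J ι ℝ)) :
    (S * V * Sᵀ).trace = minTrace c V := by
  refine le_antisymm (le_ciInf fun T => ?_) (minTrace_le hV hS)
  have hTS := mul_mem T.2 (inv_mem_localSymplecticGroup hS)
  have hSS : S⁻¹ * S = 1 := nonsing_inv_mul _ (SymplecticGroup.symplectic_det hS.1)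
  calc (S * V * Sᵀ).trace
      = (pinch (Sum.elim c c) (S * V * Sᵀ)).trace := (trace_pinch _ _).symm
    _ ≤ (T.1 * S⁻¹ * pinch (Sum.elim c c) (S * V * Sᵀ) * (T.1 * S⁻¹)ᵀ).trace :=
        trace_le_of_commute_J (posSemidef_pinch _ (posSemidef_mul_mul_transpose hV S)) hJ hTS.1
    _ = (T.1 * S⁻¹ * (S * V * Sᵀ) * (T.1 * S⁻¹)ᵀ).trace := hTS.2.trace_mul_pinch_mul_transpose _
    _ = (T.1 * (S⁻¹ * S) * V * (T.1 * (S⁻¹ * S))ᵀ).trace := by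
        simp only [transpose_mul, Matrix.mul_assoc]
    _ = (T.1 * V * T.1ᵀ).trace := by rw [hSS, Matrix.mul_one]

theorem trace_eq_minTrace_iff [DecidableEq α] (hV : V.PosSemidef)
    (hS : S ∈ localSymplecticGroup c) :
    (S * V * Sᵀ).trace = minTrace c V ↔
      Commute (pinch (Sum.elim c c) (S * V * Sᵀ)) (J ι ℝ) := by
  refine ⟨fun h => commute_pinch_J_of_forall_trace_le ?_ fun T hT => ?_,
    trace_eq_minTrace_of_commute hV hS⟩
  · simpa only [conjTranspose_eq_transpose_of_trivial] using
      (posSemidef_mul_mul_transpose hV S).isHermitian.eq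
  · rw [h]
    simpa only [transpose_mul, Matrix.mul_assoc] using minTrace_le hV (mul_mem hT hS)

end LeastTrace

section DirectSum

variable {ι ι' : Type*}

/-- The direct sum of two matrices on phase spaces, acting on the phase space of the composite
system, whose coordinates are ordered as `((q, q'), (p, p'))`. -/
def phaseSum (V : PhaseMatrix ι) (V' : PhaseMatrix ι') : PhaseMatrix (ι ⊕ ι') :=
  (fromBlocks V 0 0 V').submatrix (Equiv.sumSumSumComm ι ι' ι ι') (Equiv.sumSumSumComm ι ι' ι ι')

theorem transpose_phaseSum (V : PhaseMatrix ι) (V' : PhaseMatrix ι') :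
    (phaseSum V V')ᵀ = phaseSum Vᵀ V'ᵀ := by
  simp only [phaseSum, transpose_submatrix, fromBlocks_transpose, transpose_zero]

theorem phaseSum_J [DecidableEq ι] [DecidableEq ι'] :
    phaseSum (J ι ℝ) (J ι' ℝ) = J (ι ⊕ ι') ℝ := by
  ext ((i | i) | (i | i)) ((j | j) | (j | j)) <;>
    simp [phaseSum, J, one_apply]

theorem pinch_phaseSum {α : Type*} [DecidableEq α] (c : ι → α) (c' : ι' → α) (V : PhaseMatrix ι)
    (V' : PhaseMatrix ι') :
    pinch (Sum.elim (Sum.elim c c') (Sum.elim c c')) (phaseSum V V') =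
      phaseSum (pinch (Sum.elim c c) V) (pinch (Sum.elim c' c') V') := by
  ext ((i | i) | (i | i)) ((j | j) | (j | j)) <;>
    first
      | rfl
      | exact ite_self _

theorem posSemidef_phaseSum [Finite ι] [Finite ι'] {V : PhaseMatrix ι} {V' : PhaseMatrix ι'}
    (hV : V.PosSemidef) (hV' : V'.PosSemidef) : (phaseSum V V').PosSemidef := by
  have := Fintype.ofFinite ι
  have := Fintype.ofFinite ι'
  refine PosSemidef.submatrix (.of_dotProduct_mulVec_nonneg ?_ fun x => ?_) _
  · exact hV.isHermitian.fromBlocks conjTranspose_zero hV'.isHermitian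
  · obtain ⟨y, z, rfl⟩ : ∃ y z, x = Sum.elim y z := ⟨_, _, (Sum.elim_comp_inl_inr x).symm⟩
    have hy := hV.dotProduct_mulVec_nonneg y
    have hz := hV'.dotProduct_mulVec_nonneg z
    simp only [star_trivial] at hy hz ⊢
    simpa only [fromBlocks_mulVec, Sum.elim_comp_inl, Sum.elim_comp_inr, zero_mulVec, add_zero,
      zero_add, sumElim_dotProduct_sumElim] using add_nonneg hy hz

variable [Fintype ι] [Fintype ι']

theorem phaseSum_mul_phaseSum (V W : PhaseMatrix ι) (V' W' : PhaseMatrix ι') :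
    phaseSum V V' * phaseSum W W' = phaseSum (V * W) (V' * W') := by
  simp only [phaseSum, submatrix_mul_equiv, fromBlocks_multiply, Matrix.mul_zero, Matrix.zero_mul,
    add_zero, zero_add]

theorem phaseSum_conj (S V : PhaseMatrix ι) (S' V' : PhaseMatrix ι') :
    phaseSum S S' * phaseSum V V' * (phaseSum S S')ᵀ =
      phaseSum (S * V * Sᵀ) (S' * V' * S'ᵀ) := by
  rw [transpose_phaseSum, phaseSum_mul_phaseSum, phaseSum_mul_phaseSum]

theorem trace_phaseSum (V : PhaseMatrix ι) (V' : PhaseMatrix ι') :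
    (phaseSum V V').trace = V.trace + V'.trace := by
  refine (Equiv.sum_comp (Equiv.sumSumSumComm ι ι' ι ι') fun i => fromBlocks V 0 0 V' i i).trans ?_
  exact Fintype.sum_sum_type _

variable [DecidableEq ι] [DecidableEq ι'] {α : Type*} {c : ι → α} {c' : ι' → α}

theorem phaseSum_mem_localSymplecticGroup {S : PhaseMatrix ι} {S' : PhaseMatrix ι'}
    (hS : S ∈ localSymplecticGroup c) (hS' : S' ∈ localSymplecticGroup c') :
    phaseSum S S' ∈ localSymplecticGroup (Sum.elim c c') := by
  constructor
  · rw [SymplecticGroup.mem_iff, ← phaseSum_J, phaseSum_conj, SymplecticGroup.mem_iff.1 hS.1,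
      SymplecticGroup.mem_iff.1 hS'.1]
  · rintro ((i | i) | (i | i)) ((j | j) | (j | j)) h <;>
      first
        | rfl
        | exact hS.2 h
        | exact hS'.2 h

theorem minTrace_phaseSum {V : PhaseMatrix ι} {V' : PhaseMatrix ι'} (hV : V.PosDef)
    (hV' : V'.PosDef) :
    minTrace (Sum.elim c c') (phaseSum V V') = minTrace c V + minTrace c' V' := by
  classical
  obtain ⟨S, hS, hmin⟩ := exists_trace_eq_minTrace c hV
  obtain ⟨S', hS', hmin'⟩ := exists_trace_eq_minTrace c' hV'
  have comm := ((trace_eq_minTrace_iff hV.posSemidef hS).1 hmin).eq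
  have comm' := ((trace_eq_minTrace_iff hV'.posSemidef hS').1 hmin').eq
  have hsum : Commute (pinch (Sum.elim (Sum.elim c c') (Sum.elim c c'))
      (phaseSum S S' * phaseSum V V' * (phaseSum S S')ᵀ)) (J (ι ⊕ ι') ℝ) := by
    rw [phaseSum_conj, pinch_phaseSum, ← phaseSum_J, Commute, SemiconjBy, phaseSum_mul_phaseSum,
      phaseSum_mul_phaseSum, comm, comm']
  rw [← trace_eq_minTrace_of_commute (posSemidef_phaseSum hV.posSemidef hV'.posSemidef)
    (phaseSum_mem_localSymplecticGroup hS hS') hsum, phaseSum_conj, trace_phaseSum, hmin, hmin']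

end DirectSum

/-! ### Lower triangular representatives -/

section Shear

variable {ι α : Type*} [Fintype ι] [DecidableEq ι] {c : ι → α}

/-- The symplectic matrix of `q ↦ A⁻¹ q`, `p ↦ Q A⁻¹ q + Aᵀ p`. -/
def shearMatrix (A Q : Matrix ι ι ℝ) : PhaseMatrix ι :=
  fromBlocks A⁻¹ 0 (Q * A⁻¹) Aᵀ

theorem shearMatrix_mem_symplecticGroup {A Q : Matrix ι ι ℝ} (hA : IsUnit A.det) (hQ : Qᵀ = Q) :
    shearMatrix A Q ∈ symplecticGroup ι ℝ := by
  rw [shearMatrix, SymplecticGroup.fromBlocks_mem_iff]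
  refine ⟨?_, ?_, ?_⟩
  · rw [transpose_mul, hQ, Matrix.mul_assoc]
  · rw [transpose_zero, Matrix.zero_mul, Matrix.mul_zero]
  · rw [Matrix.mul_zero, sub_zero, ← transpose_mul, mul_nonsing_inv _ hA,
      transpose_one]

theorem transpose_mul_self_shearMatrix {X Y A : Matrix ι ι ℝ} (hA : IsUnit A.det) (hAs : Aᵀ = A)
    (hXs : Xᵀ = X) (hW : fromBlocks X Yᵀ Y (A * A) ∈ symplecticGroup ι ℝ) :
    (A⁻¹ * Y * A)ᵀ = A⁻¹ * Y * A ∧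
      (shearMatrix A (A⁻¹ * Y * A))ᵀ * shearMatrix A (A⁻¹ * Y * A) =
        fromBlocks X Yᵀ Y (A * A) := by
  obtain ⟨-, hY, hX⟩ := SymplecticGroup.fromBlocks_mem_iff.1 hW
  rw [transpose_transpose, transpose_mul, hAs] at hY
  rw [hXs, sub_eq_iff_eq_add] at hX
  have hAis : A⁻¹ᵀ = A⁻¹ := by rw [transpose_nonsing_inv, hAs]
  have cancel (B : Matrix ι ι ℝ) : A * (A⁻¹ * B) = B := mul_nonsing_inv_cancel_left _ _ hA
  have cancel' (B : Matrix ι ι ℝ) : A⁻¹ * (A * B) = B := nonsing_inv_mul_cancel_left _ _ hA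
  have hA1 : A * A⁻¹ = 1 := mul_nonsing_inv _ hA
  have hYt : Yᵀ * (A⁻¹ * A⁻¹) = A⁻¹ * (A⁻¹ * Y) := by
    calc Yᵀ * (A⁻¹ * A⁻¹) = A⁻¹ * (A⁻¹ * (A * A * Yᵀ)) * (A⁻¹ * A⁻¹) := by
          simp only [Matrix.mul_assoc, cancel']
      _ = A⁻¹ * (A⁻¹ * Y) := by
          simp only [← hY, Matrix.mul_assoc, cancel, hA1, Matrix.mul_one]
  have hXY : X = A⁻¹ * A⁻¹ + Yᵀ * (A⁻¹ * (A⁻¹ * Y)) := by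
    calc X = X * (A * A) * (A⁻¹ * A⁻¹) := by
          simp only [Matrix.mul_assoc, cancel, hA1, Matrix.mul_one]
      _ = A⁻¹ * A⁻¹ + Yᵀ * (A⁻¹ * (A⁻¹ * Y)) := by
          rw [hX, Matrix.add_mul, Matrix.one_mul, Matrix.mul_assoc, hYt]
  constructor
  · calc (A⁻¹ * Y * A)ᵀ = A * (Yᵀ * (A⁻¹ * A⁻¹)) * A := by
          simp only [transpose_mul, hAs, hAis, Matrix.mul_assoc, nonsing_inv_mul _ hA,
            Matrix.mul_one]
      _ = A⁻¹ * Y * A := by rw [hYt, cancel]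
  · simp only [shearMatrix, fromBlocks_transpose, fromBlocks_multiply, transpose_mul, hAs, hAis,
      Matrix.mul_assoc, hA1, nonsing_inv_mul _ hA, Matrix.mul_one, cancel, transpose_zero,
      Matrix.zero_mul, Matrix.mul_zero, zero_add, ← hXY]

theorem exists_shearMatrix {S : PhaseMatrix ι} (hS : S ∈ localSymplecticGroup c) :
    ∃ A Q : Matrix ι ι ℝ, IsUnit A.det ∧ Qᵀ = Q ∧ IsBlockDiagonal c A ∧ IsBlockDiagonal c Q ∧
      (shearMatrix A Q)ᵀ * shearMatrix A Q = Sᵀ * S := by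
  obtain ⟨X, Z, Y, D, hW⟩ : ∃ X Z Y D, Sᵀ * S = fromBlocks X Z Y D :=
    ⟨_, _, _, _, (fromBlocks_toBlocks (Sᵀ * S)).symm⟩
  have symplectic : fromBlocks X Z Y D ∈ symplecticGroup ι ℝ :=
    hW ▸ mul_mem (SymplecticGroup.transpose_mem hS.1) hS.1
  have block : IsBlockDiagonal (Sum.elim c c) (fromBlocks X Z Y D) :=
    hW ▸ hS.2.transpose.mul hS.2
  have symm : (fromBlocks X Z Y D)ᵀ = fromBlocks X Z Y D := by
    rw [← hW, transpose_mul, transpose_transpose]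
  have posDef : (fromBlocks X Z Y D).PosDef := by
    rw [← hW]
    simpa only [conjTranspose_eq_transpose_of_trivial] using PosDef.conjTranspose_mul_self S
      (mulVec_injective_of_isUnit
        ((isUnit_iff_isUnit_det S).2 (SymplecticGroup.symplectic_det hS.1)))
  have hD : D.PosDef := posDef.submatrix Sum.inr_injective
  rw [fromBlocks_transpose, fromBlocks_inj] at symm
  obtain ⟨hXs, hYZ, -, -⟩ := symm
  have hDb : IsBlockDiagonal c D := fun i j h => @block (Sum.inr i) (Sum.inr j) h
  have hYb : IsBlockDiagonal c Y := fun i j h => @block (Sum.inr i) (Sum.inl j) h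
  obtain ⟨A, hAb, hAs, rfl⟩ := hDb.exists_sqrt hD.posSemidef
  have hA : IsUnit A.det :=
    (isUnit_iff_isUnit_det A).1 (isUnit_of_mul_isUnit_left hD.isUnit)
  rw [← hYZ] at symplectic hW
  obtain ⟨hQ, hshear⟩ := transpose_mul_self_shearMatrix hA hAs hXs symplectic
  exact ⟨A, A⁻¹ * Y * A, hA, hQ, hAb, (hAb.inv.mul hYb).mul hAb, hshear.trans hW.symm⟩

end Shear

/-! ### Weyl operators -/

section Weyl

variable {ι : Type} [Fintype ι]

theorem coeFn_weyl (ξ : ι ⊕ ι → ℝ) (ψ : ModeSpace ι) :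
    (weyl ξ ψ : Config ι → ℂ) =ᵐ[volume] weylFun ξ ψ :=
  MemLp.coeFn_toLp _

/-- The translation of configurations effected by the momentum part of `ξ`. -/
abbrev weylShift (ξ : ι ⊕ ι → ℝ) : Config ι := WithLp.toLp 2 fun i => ξ (Sum.inr i)

theorem ae_comp_add_right {p : Config ι → Prop} (h : ∀ᵐ x, p x) (b : Config ι) :
    ∀ᵐ x, p (x + b) :=
  (measurePreserving_add_right volume b).quasiMeasurePreserving.ae h

theorem weylFun_congr_ae {f g : Config ι → ℂ} (h : f =ᵐ[volume] g) (ξ : ι ⊕ ι → ℝ) :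
    weylFun ξ f =ᵐ[volume] weylFun ξ g := by
  filter_upwards [ae_comp_add_right h (weylShift ξ)] with x hx
  rw [weylFun, weylFun, hx]

theorem weyl_eq_of_ae {f : Config ι → ℂ} {ψ φ : ModeSpace ι} {ξ : ι ⊕ ι → ℝ}
    (h : (ψ : Config ι → ℂ) =ᵐ[volume] f) (h' : (φ : Config ι → ℂ) =ᵐ[volume] weylFun ξ f) :
    weyl ξ ψ = φ :=
  Lp.ext ((coeFn_weyl ξ ψ).trans ((weylFun_congr_ae h ξ).trans h'.symm))

theorem weylFun_elim (a b : ι → ℝ) (f : Config ι → ℂ) (x : Config ι) :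
    weylFun (Sum.elim a b) f x =
      Complex.exp (Complex.I * ((a ⬝ᵥ x.ofLp + 1 / 2 * (a ⬝ᵥ b) : ℝ) : ℂ)) *
        f (x + WithLp.toLp 2 b) :=
  rfl

theorem weylFun_elim_zero_right (a : ι → ℝ) (f : Config ι → ℂ) (x : Config ι) :
    weylFun (Sum.elim a 0) f x =
      Complex.exp (Complex.I * ((a ⬝ᵥ x.ofLp : ℝ) : ℂ)) * f x := by
  rw [weylFun_elim, dotProduct_zero, mul_zero, add_zero, WithLp.toLp_zero, add_zero]

theorem weyl_zero (ψ : ModeSpace ι) : weyl 0 ψ = ψ := by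
  refine weyl_eq_of_ae (Filter.EventuallyEq.refl _ _) (Filter.Eventually.of_forall fun x => ?_)
  rw [← Sum.elim_zero_zero, weylFun_elim_zero_right]
  simp

theorem weyl_add (ξ : ι ⊕ ι → ℝ) (ψ φ : ModeSpace ι) : weyl ξ (ψ + φ) = weyl ξ ψ + weyl ξ φ := by
  refine weyl_eq_of_ae (Lp.coeFn_add ψ φ) ?_
  filter_upwards [Lp.coeFn_add (weyl ξ ψ) (weyl ξ φ), coeFn_weyl ξ ψ, coeFn_weyl ξ φ]
    with x h_add hψ hφ
  rw [h_add, Pi.add_apply, hψ, hφ]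
  simp only [weylFun, Pi.add_apply, mul_add]

theorem weyl_smul (ξ : ι ⊕ ι → ℝ) (c : ℂ) (ψ : ModeSpace ι) :
    weyl ξ (c • ψ) = c • weyl ξ ψ := by
  refine weyl_eq_of_ae (Lp.coeFn_smul c ψ) ?_
  filter_upwards [Lp.coeFn_smul c (weyl ξ ψ), coeFn_weyl ξ ψ] with x h_smul hψ
  rw [h_smul, Pi.smul_apply, hψ]
  simp only [weylFun, Pi.smul_apply, smul_eq_mul]
  ring

theorem norm_weylFun (ξ : ι ⊕ ι → ℝ) (f : Config ι → ℂ) (x : Config ι) :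
    ‖weylFun ξ f x‖ = ‖f (x + weylShift ξ)‖ := by
  rw [weylFun, norm_mul, mul_comm Complex.I, Complex.norm_exp_ofReal_mul_I, one_mul]

theorem norm_weyl (ξ : ι ⊕ ι → ℝ) (ψ : ModeSpace ι) : ‖weyl ξ ψ‖ = ‖ψ‖ := by
  rw [weyl, Lp.norm_toLp, Lp.norm_def,
    eLpNorm_congr_norm_ae (.of_forall fun x => norm_weylFun ξ ψ x)]
  exact congrArg ENNReal.toReal (eLpNorm_comp_measurePreserving (Lp.aestronglyMeasurable ψ)
    (measurePreserving_add_right volume (weylShift ξ)))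

/-- The Weyl operator `weyl ξ` as a linear isometry. -/
def weylIsometry (ξ : ι ⊕ ι → ℝ) : ModeSpace ι →ₗᵢ[ℂ] ModeSpace ι where
  toFun := weyl ξ
  map_add' := weyl_add ξ
  map_smul' := weyl_smul ξ
  norm_map' := norm_weyl ξ

theorem inner_weyl_weyl (ξ : ι ⊕ ι → ℝ) (ψ φ : ModeSpace ι) :
    inner ℂ (weyl ξ ψ) (weyl ξ φ) = inner ℂ ψ φ :=
  (weylIsometry ξ).inner_map_map ψ φ

theorem continuous_weyl (ξ : ι ⊕ ι → ℝ) : Continuous (weyl (ι := ι) ξ) :=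
  (weylIsometry ξ).continuous

theorem inner_weyl (ξ : ι ⊕ ι → ℝ) (φ ψ : ModeSpace ι) :
    inner ℂ φ (weyl ξ ψ) = ∫ x, weylFun ξ ψ x * starRingEnd ℂ (φ x) := by
  rw [L2.inner_def]
  refine integral_congr_ae ?_
  filter_upwards [coeFn_weyl ξ ψ] with x hx
  rw [hx]
  rfl

theorem weyl_weyl_comm [DecidableEq ι] (η ξ : ι ⊕ ι → ℝ) (ψ : ModeSpace ι) :
    weyl η (weyl ξ ψ) =
      Complex.exp (Complex.I * ((η ⬝ᵥ J ι ℝ *ᵥ ξ : ℝ) : ℂ)) • weyl ξ (weyl η ψ) := by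
  refine weyl_eq_of_ae (coeFn_weyl ξ ψ) ?_
  filter_upwards [Lp.coeFn_smul (Complex.exp (Complex.I * ((η ⬝ᵥ J ι ℝ *ᵥ ξ : ℝ) : ℂ)))
    (weyl ξ (weyl η ψ)), coeFn_weyl ξ (weyl η ψ), weylFun_congr_ae (coeFn_weyl η ψ) ξ]
    with x h_smul hξ hη
  have symplectic_form : η ⬝ᵥ J ι ℝ *ᵥ ξ =
      ∑ i, (ξ (Sum.inl i) * η (Sum.inr i) - η (Sum.inl i) * ξ (Sum.inr i)) := by
    simp only [J, fromBlocks_mulVec, dotProduct, Fintype.sum_sum_type, Sum.elim_inl, Sum.elim_inr,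
      zero_mulVec, neg_mulVec, one_mulVec, zero_add, add_zero, Pi.neg_apply, Function.comp_apply,
      ← Finset.sum_add_distrib]
    exact Finset.sum_congr rfl fun i _ => by ring
  rw [h_smul, Pi.smul_apply, hξ, hη, smul_eq_mul, symplectic_form]
  simp only [weylFun]
  rw [add_right_comm x, ← mul_assoc, ← mul_assoc, ← mul_assoc, ← Complex.exp_add,
    ← Complex.exp_add, ← Complex.exp_add, ← mul_add, ← mul_add, ← mul_add, ← Complex.ofReal_add,
    ← Complex.ofReal_add, ← Complex.ofReal_add]
  congr 4
  simp only [PiLp.add_apply, mul_add, Finset.sum_add_distrib, Finset.sum_sub_distrib]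
  ring

/-- The characteristic function of `ψ` is that of a Gaussian with covariance matrix `V` and
displacement `d`. -/
def HasGaussianChar (ψ : ModeSpace ι) (V : PhaseMatrix ι) (d : ι ⊕ ι → ℝ) : Prop :=
  ∀ ξ : ι ⊕ ι → ℝ, inner ℂ ψ (weyl ξ ψ) = Complex.exp (Complex.I * ((ξ ⬝ᵥ d : ℝ) : ℂ)) *
    ((Real.exp (-(1 / 4) * (ξ ⬝ᵥ V *ᵥ ξ)) : ℝ) : ℂ)

theorem hasGaussianChar_zero_iff {ψ : ModeSpace ι} {V : PhaseMatrix ι} :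
    HasGaussianChar ψ V 0 ↔
      ∀ ξ : ι ⊕ ι → ℝ, inner ℂ ψ (weyl ξ ψ) = ((Real.exp (-(1 / 4) * (ξ ⬝ᵥ V *ᵥ ξ)) : ℝ) : ℂ) := by
  simp only [HasGaussianChar, dotProduct_zero, Complex.ofReal_zero, mul_zero, Complex.exp_zero,
    one_mul]

theorem HasGaussianChar.norm_eq_one {ψ : ModeSpace ι} {V : PhaseMatrix ι} {d : ι ⊕ ι → ℝ}
    (h : HasGaussianChar ψ V d) : ‖ψ‖ = 1 := by
  have inner_self := h 0
  simp only [weyl_zero, inner_self_eq_norm_sq_to_K, zero_dotProduct, Complex.ofReal_zero, mul_zero,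
    Complex.exp_zero, Real.exp_zero, Complex.ofReal_one, mul_one] at inner_self
  exact (pow_eq_one_iff_of_nonneg (norm_nonneg _) two_ne_zero).1
    (Complex.ofReal_injective (by simpa using inner_self))

theorem exists_inner_weyl_eq_zero_of_weyl_eq_self {ψ : ModeSpace ι} {ξ : ι ⊕ ι → ℝ}
    (hξ : ξ ≠ 0) (h : weyl ξ ψ = ψ) : ∃ η, inner ℂ ψ (weyl η ψ) = 0 := by
  classical
  have hpos : 0 < ξ ⬝ᵥ ξ := by simpa only [star_trivial] using dotProduct_star_self_pos_iff.2 hξ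
  have hJ : (J ι ℝ *ᵥ ξ) ⬝ᵥ (J ι ℝ *ᵥ ξ) = ξ ⬝ᵥ ξ := by
    rw [dotProduct_mulVec, ← mulVec_transpose, mulVec_mulVec, J_transpose, Matrix.neg_mul,
      J_squared, neg_neg, one_mulVec]
  -- `η` is scaled so that `weyl η` anticommutes with `weyl ξ`.
  let η : ι ⊕ ι → ℝ := (Real.pi / (ξ ⬝ᵥ ξ)) • J ι ℝ *ᵥ ξ
  have anticommute : weyl η ψ = -weyl ξ (weyl η ψ) := by
    conv_lhs => rw [← h, weyl_weyl_comm, smul_dotProduct, hJ, smul_eq_mul,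
      div_mul_cancel₀ _ hpos.ne', mul_comm, Complex.exp_pi_mul_I, neg_one_smul]
  have inner_eq_neg : inner ℂ ψ (weyl η ψ) = -inner ℂ ψ (weyl η ψ) := calc
    inner ℂ ψ (weyl η ψ) = -inner ℂ ψ (weyl ξ (weyl η ψ)) := by
      conv_lhs => rw [anticommute, inner_neg_right]
    _ = -inner ℂ (weyl ξ ψ) (weyl ξ (weyl η ψ)) := by rw [h]
    _ = -inner ℂ ψ (weyl η ψ) := by rw [inner_weyl_weyl]
  exact ⟨η, self_eq_neg.1 inner_eq_neg⟩

theorem HasGaussianChar.posDef {ψ : ModeSpace ι} {V : PhaseMatrix ι} (h : HasGaussianChar ψ V 0)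
    (hV : Vᵀ = V) : V.PosDef := by
  have hn := h.norm_eq_one
  rw [hasGaussianChar_zero_iff] at h
  refine .of_dotProduct_mulVec_pos (isHermitian_iff_isSymm.2 hV) fun {ξ} hξ => ?_
  rw [star_trivial]
  by_contra! hle
  have hexp : Real.exp (-(1 / 4) * (ξ ⬝ᵥ V *ᵥ ξ)) = 1 := by
    refine le_antisymm ?_ (Real.one_le_exp (by linarith))
    have cauchy_schwarz := norm_inner_le_norm (𝕜 := ℂ) ψ (weyl ξ ψ)
    rwa [norm_weyl, hn, h, Complex.norm_real, Real.norm_eq_abs, Real.abs_exp, mul_one]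
      at cauchy_schwarz
  have fixed : ψ = weyl ξ ψ := (inner_eq_one_iff_of_norm_eq_one hn (by rw [norm_weyl, hn])).1
    (by rw [h, hexp, Complex.ofReal_one])
  obtain ⟨η, hη⟩ := exists_inner_weyl_eq_zero_of_weyl_eq_self hξ fixed.symm
  rw [h] at hη
  exact (Real.exp_pos _).ne' (Complex.ofReal_eq_zero.1 hη)

/-- `U` acts on the quadratures by `R ↦ S R + d` (in the Heisenberg picture). -/
def Implements (U : ModeSpace ι ≃ₗᵢ[ℂ] ModeSpace ι) (S : PhaseMatrix ι) (d : ι ⊕ ι → ℝ) : Prop :=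
  ∀ (ξ : ι ⊕ ι → ℝ) (φ : ModeSpace ι),
    weyl ξ (U φ) = Complex.exp (Complex.I * ((ξ ⬝ᵥ d : ℝ) : ℂ)) • U (weyl (Sᵀ *ᵥ ξ) φ)

theorem HasGaussianChar.map {ψ : ModeSpace ι} {V S : PhaseMatrix ι} {d : ι ⊕ ι → ℝ}
    {U : ModeSpace ι ≃ₗᵢ[ℂ] ModeSpace ι} (h : HasGaussianChar ψ V 0) (hU : Implements U S d) :
    HasGaussianChar (U ψ) (S * V * Sᵀ) d := by
  intro ξ
  rw [hU, inner_smul_right, U.inner_map_map, hasGaussianChar_zero_iff.1 h, mulVec_transpose,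
    ← dotProduct_mulVec, ← mulVec_transpose, mulVec_mulVec, mulVec_mulVec, Matrix.mul_assoc]

end Weyl

/-! ### Energy of Gaussian states -/

section SecondMoment

open ProbabilityTheory

theorem lintegral_sq_gaussianReal (m : ℝ) (v : NNReal) :
    ∫⁻ y, ENNReal.ofReal (y ^ 2) ∂gaussianReal m v = ENNReal.ofReal (v + m ^ 2) := by
  have hmem : MemLp (id : ℝ → ℝ) 2 (gaussianReal m v) := memLp_id_gaussianReal 2
  have variance_eq := variance_eq_sub hmem
  simp only [variance_id_gaussianReal, Pi.pow_apply, id_eq, integral_id_gaussianReal]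
    at variance_eq
  rw [← ofReal_integral_eq_lintegral_ofReal (f := fun y : ℝ => y ^ 2) hmem.integrable_sq
    (.of_forall fun y => sq_nonneg y), variance_eq, sub_add_cancel]

variable {Ω : Type*} [MeasurableSpace Ω] {μ : Measure Ω} {X f : Ω → ℝ} {m : ℝ} {v : NNReal}

theorem map_withDensity_eq_gaussianReal (hX : Measurable X) (hf : Integrable f μ) (hf0 : 0 ≤ f)
    (h : ∀ t : ℝ, ∫ x, Complex.exp (Complex.I * ((t * X x : ℝ) : ℂ)) * (f x : ℂ) ∂μ =
      Complex.exp (Complex.I * ((t * m : ℝ) : ℂ) - v * t ^ 2 / 2)) :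
    (μ.withDensity fun x => ENNReal.ofReal (f x)).map X = gaussianReal m v := by
  have := isFiniteMeasure_withDensity_ofReal hf.2
  refine Measure.ext_of_charFun (funext fun t => ?_)
  rw [charFun_apply_real, charFun_gaussianReal, integral_map hX.aemeasurable (by fun_prop),
    integral_withDensity_eq_integral_toReal_smul₀ hf.1.aemeasurable.ennreal_ofReal (by simp)]
  convert h t using 1
  · refine integral_congr_ae (.of_forall fun x => ?_)
    simp only [ENNReal.toReal_ofReal (hf0 x), Complex.real_smul]
    push_cast
    ring_nf
  · push_cast
    ring_nf

theorem lintegral_sq_mul_eq_of_charFun (hX : Measurable X) (hf : Integrable f μ) (hf0 : 0 ≤ f)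
    (h : ∀ t : ℝ, ∫ x, Complex.exp (Complex.I * ((t * X x : ℝ) : ℂ)) * (f x : ℂ) ∂μ =
      Complex.exp (Complex.I * ((t * m : ℝ) : ℂ) - v * t ^ 2 / 2)) :
    ∫⁻ x, ENNReal.ofReal (X x ^ 2 * f x) ∂μ = ENNReal.ofReal (v + m ^ 2) := by
  rw [← lintegral_sq_gaussianReal, ← map_withDensity_eq_gaussianReal hX hf hf0 h,
    lintegral_map (by fun_prop) hX,
    lintegral_withDensity_eq_lintegral_mul₀ hf.1.aemeasurable.ennreal_ofReal (by fun_prop)]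
  refine lintegral_congr fun x => ?_
  rw [Pi.mul_apply, mul_comm, ENNReal.ofReal_mul (hf0 x)]

end SecondMoment

section Energy

theorem elim_single_zero {ι ι' M : Type*} [DecidableEq ι] [DecidableEq ι'] [Zero M] (i : ι)
    (t : M) :
    Sum.elim (Pi.single i t) (0 : ι' → M) = Pi.single (Sum.inl i) t := by
  simp only [Pi.single, ← Sum.update_elim_inl, Sum.elim_zero_zero]

theorem elim_zero_single {ι ι' M : Type*} [DecidableEq ι] [DecidableEq ι'] [Zero M] (i : ι')
    (t : M) :
    Sum.elim (0 : ι → M) (Pi.single i t) = Pi.single (Sum.inr i) t := by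
  simp only [Pi.single, ← Sum.update_elim_inr, Sum.elim_zero_zero]

variable {ι : Type} [Fintype ι]

theorem inner_weyl_elim_zero_right (a : ι → ℝ) (φ : ModeSpace ι) :
    inner ℂ φ (weyl (Sum.elim a 0) φ) =
      ∫ x : Config ι, Complex.exp (Complex.I * ((a ⬝ᵥ x.ofLp : ℝ) : ℂ)) *
        ((‖φ x‖ ^ 2 : ℝ) : ℂ) := by
  simp only [inner_weyl, weylFun_elim_zero_right, mul_assoc, Complex.mul_conj,
    Complex.normSq_eq_norm_sq]

theorem lintegral_coord_sq_mul_norm_sq [DecidableEq ι] {φ : ModeSpace ι} {i : ι} {s m v : ℝ}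
    (hv : 0 ≤ v)
    (h : ∀ t : ℝ, inner ℂ φ (weyl (Sum.elim (Pi.single i (t * s)) 0) φ) =
      Complex.exp (Complex.I * ((t * m : ℝ) : ℂ)) *
        ((Real.exp (-(1 / 4) * (v * t ^ 2)) : ℝ) : ℂ)) :
    ∫⁻ x : Config ι, ENNReal.ofReal ((1 / 2) * (s * x i) ^ 2 * ‖φ x‖ ^ 2) =
      ENNReal.ofReal (v / 4 + m ^ 2 / 2) := by
  have integrable : Integrable (fun x : Config ι => ‖φ x‖ ^ 2) :=
    (Lp.memLp φ).integrable_norm_pow two_ne_zero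
  lift v to NNReal using hv
  have second_moment := lintegral_sq_mul_eq_of_charFun (X := fun x : Config ι => s * x i) (m := m)
    (v := v / 2) (by fun_prop) integrable (fun _ => by positivity) fun t => by
      convert h t using 1
      · rw [inner_weyl_elim_zero_right]
        simp only [single_dotProduct, mul_assoc]
      · rw [Complex.ofReal_exp, ← Complex.exp_add]
        push_cast
        ring_nf
  simp only [mul_assoc]
  simp only [ENNReal.ofReal_mul (show (0 : ℝ) ≤ 1 / 2 by norm_num)]
  rw [lintegral_const_mul' _ _ ENNReal.ofReal_ne_top, second_moment,
    ← ENNReal.ofReal_mul (by norm_num), NNReal.coe_div, NNReal.coe_ofNat]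
  ring_nf

theorem fourier_schwartz_comp_add_right (f : SchwartzMap (Config ι) ℂ) (b k : Config ι) :
    𝓕 (fun x => f (x + b)) k =
      Complex.exp (Complex.I * (((2 * Real.pi) • b.ofLp ⬝ᵥ k.ofLp : ℝ) : ℂ)) * 𝓕 f k := by
  refine (congrFun (VectorFourier.fourierIntegral_comp_add_right Real.fourierChar volume
    (innerₗ (Config ι)) f b) k).trans ?_
  have inner_eq : 2 * Real.pi * innerₗ (Config ι) b k = (2 * Real.pi) • b.ofLp ⬝ᵥ k.ofLp := by
    rw [smul_dotProduct, smul_eq_mul, innerₗ_apply_apply, EuclideanSpace.inner_eq_star_dotProduct,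
      star_trivial, dotProduct_comm]
  rw [Circle.smul_def, Real.fourierChar_apply, smul_eq_mul, mul_comm Complex.I, inner_eq]
  rfl

theorem fourier_weyl_elim_zero_left (b : ι → ℝ) (φ : ModeSpace ι) :
    (𝓕 (weyl (Sum.elim 0 b) φ) : ModeSpace ι) =
      weyl (Sum.elim ((2 * Real.pi) • b) 0) (𝓕 φ : ModeSpace ι) := by
  have continuous_fourier : Continuous fun φ : ModeSpace ι => (𝓕 φ : ModeSpace ι) :=
    (Lp.fourierTransformₗᵢ (Config ι) ℂ).continuous
  refine DenseRange.induction_on (SchwartzMap.denseRange_toLpCLM (E := Config ι) (F := ℂ)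
    (μ := volume) (p := 2) ENNReal.ofNat_ne_top) φ
    (isClosed_eq (continuous_fourier.comp (continuous_weyl _))
      ((continuous_weyl _).comp continuous_fourier)) fun f => ?_
  let translate := SchwartzMap.compSubConstCLM ℂ (-(WithLp.toLp 2 b : Config ι)) f
  have coe_translate : (translate : Config ι → ℂ) = fun x => f (x + WithLp.toLp 2 b) := by
    ext x
    simp [translate]
  have weyl_toLp : weyl (Sum.elim 0 b) (f.toLp 2 : ModeSpace ι) = translate.toLp 2 := by
    refine weyl_eq_of_ae (f.coeFn_toLp 2 volume) ((SchwartzMap.coeFn_toLp _ 2 volume).trans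
      (.of_forall fun x => ?_))
    simp [weylFun, coe_translate]
  change (𝓕 (weyl (Sum.elim 0 b) (f.toLp 2 : ModeSpace ι)) : ModeSpace ι) =
    weyl _ (𝓕 (f.toLp 2 : ModeSpace ι))
  rw [weyl_toLp, SchwartzMap.toLp_fourier_eq, SchwartzMap.toLp_fourier_eq]
  refine (weyl_eq_of_ae ((𝓕 f).coeFn_toLp 2 volume) ((SchwartzMap.coeFn_toLp _ 2 volume).trans
    (.of_forall fun k => ?_))).symm
  rw [SchwartzMap.fourier_coe, coe_translate, fourier_schwartz_comp_add_right,
    weylFun_elim_zero_right, SchwartzMap.fourier_coe]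

theorem HasGaussianChar.inner_weyl_single [DecidableEq ι] {ψ : ModeSpace ι} {V : PhaseMatrix ι}
    {d : ι ⊕ ι → ℝ} (h : HasGaussianChar ψ V d) (x : ι ⊕ ι) (t : ℝ) :
    inner ℂ ψ (weyl (Pi.single x t) ψ) = Complex.exp (Complex.I * ((t * d x : ℝ) : ℂ)) *
      ((Real.exp (-(1 / 4) * (V x x * t ^ 2)) : ℝ) : ℂ) := by
  rw [h, single_dotProduct, single_dotProduct, mulVec_single]
  congr 4
  simp only [Pi.smul_apply, col_apply, op_smul_eq_smul, smul_eq_mul]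
  ring

theorem HasGaussianChar.lintegral_position {ψ : ModeSpace ι} {V : PhaseMatrix ι} {d : ι ⊕ ι → ℝ}
    (h : HasGaussianChar ψ V d) (i : ι) (hV : 0 ≤ V (Sum.inl i) (Sum.inl i)) :
    ∫⁻ x : Config ι, ENNReal.ofReal ((1 / 2) * (x i) ^ 2 * ‖ψ x‖ ^ 2) =
      ENNReal.ofReal (V (Sum.inl i) (Sum.inl i) / 4 + d (Sum.inl i) ^ 2 / 2) := by
  classical
  have moment := lintegral_coord_sq_mul_norm_sq (φ := ψ) (i := i) (s := 1) (m := d (Sum.inl i)) hV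
    fun t => by rw [mul_one, ← h.inner_weyl_single, ← elim_single_zero]
  simpa only [one_mul] using moment

theorem HasGaussianChar.lintegral_momentum {ψ : ModeSpace ι} {V : PhaseMatrix ι} {d : ι ⊕ ι → ℝ}
    (h : HasGaussianChar ψ V d) (i : ι) (hV : 0 ≤ V (Sum.inr i) (Sum.inr i)) :
    ∫⁻ k : Config ι,
        ENNReal.ofReal ((1 / 2) * (2 * Real.pi * k i) ^ 2 * ‖(𝓕 ψ : ModeSpace ι) k‖ ^ 2) =
      ENNReal.ofReal (V (Sum.inr i) (Sum.inr i) / 4 + d (Sum.inr i) ^ 2 / 2) := by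
  classical
  refine lintegral_coord_sq_mul_norm_sq hV fun t => ?_
  rw [← h.inner_weyl_single, ← elim_zero_single, ← Lp.inner_fourier_eq ψ,
    fourier_weyl_elim_zero_left, ← Pi.single_smul, smul_eq_mul, mul_comm t]

theorem HasGaussianChar.energy_eq {ψ : ModeSpace ι} {V : PhaseMatrix ι} {d : ι ⊕ ι → ℝ}
    (h : HasGaussianChar ψ V d) (hV : ∀ x, 0 ≤ V x x) :
    energy ψ = ENNReal.ofReal (V.trace / 4 + d ⬝ᵥ d / 2) := by
  have moment_nonneg : ∀ x, 0 ≤ V x x / 4 + d x ^ 2 / 2 := fun x => by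
    have := hV x
    positivity
  simp only [energy, h.lintegral_position _ (hV _), h.lintegral_momentum _ (hV _)]
  simp only [← ENNReal.ofReal_add (moment_nonneg _) (moment_nonneg _)]
  rw [← ENNReal.ofReal_sum_of_nonneg fun i _ => add_nonneg (moment_nonneg _) (moment_nonneg _)]
  congr 1
  simp only [trace, diag, dotProduct, Fintype.sum_sum_type, Finset.sum_add_distrib,
    ← Finset.sum_div, sq]
  ring

end Energy

/-! ### Gaussian unitaries of linear substitutions and chirps -/

section ShearUnitary

variable {ι : Type} [Fintype ι] [DecidableEq ι]

/-- The wave function `√|det A| exp (i xᵀQx / 2) ψ (A x)`. -/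
def shearFun (A Q : Matrix ι ι ℝ) (ψ : Config ι → ℂ) (x : Config ι) : ℂ :=
  (Real.sqrt |A.det| : ℂ) *
    (Complex.exp (Complex.I * ((1 / 2 * (x.ofLp ⬝ᵥ Q *ᵥ x.ofLp) : ℝ) : ℂ)) *
      ψ (toEuclideanCLM (𝕜 := ℝ) A x))

theorem shearFun_add (A Q : Matrix ι ι ℝ) (f g : Config ι → ℂ) :
    shearFun A Q (f + g) = shearFun A Q f + shearFun A Q g := by
  ext x
  simp only [shearFun, Pi.add_apply, mul_add]

theorem shearFun_smul (A Q : Matrix ι ι ℝ) (c : ℂ) (f : Config ι → ℂ) :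
    shearFun A Q (c • f) = c • shearFun A Q f := by
  ext x
  simp only [shearFun, Pi.smul_apply, smul_eq_mul]
  ring

theorem norm_shearFun (A Q : Matrix ι ι ℝ) (f : Config ι → ℂ) (x : Config ι) :
    ‖shearFun A Q f x‖ = ‖(Real.sqrt |A.det| : ℂ) • f (toEuclideanCLM (𝕜 := ℝ) A x)‖ := by
  rw [shearFun, norm_mul, norm_mul, mul_comm Complex.I, Complex.norm_exp_ofReal_mul_I, one_mul,
    norm_smul]

theorem shearFun_shearFun (A B Q T : Matrix ι ι ℝ) (f : Config ι → ℂ) :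
    shearFun A Q (shearFun B T f) = shearFun (B * A) (Q + Aᵀ * T * A) f := by
  ext x
  have quadratic : x.ofLp ⬝ᵥ (Q + Aᵀ * T * A) *ᵥ x.ofLp =
      x.ofLp ⬝ᵥ Q *ᵥ x.ofLp + (A *ᵥ x.ofLp) ⬝ᵥ T *ᵥ A *ᵥ x.ofLp := by
    rw [add_mulVec, dotProduct_add, Matrix.mul_assoc, ← mulVec_mulVec, dotProduct_mulVec _ Aᵀ,
      vecMul_transpose, ← mulVec_mulVec]
  simp only [shearFun, quadratic, det_mul, abs_mul, Real.sqrt_mul (abs_nonneg _), map_mul,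
    ofLp_toEuclideanCLM, mul_add, Complex.ofReal_add, Complex.ofReal_mul, Complex.exp_add,
    mul_apply_eq_comp]
  ring

theorem shearFun_one_zero (f : Config ι → ℂ) : shearFun 1 0 f = f := by
  ext x
  simp only [shearFun, det_one, abs_one, Real.sqrt_one, Complex.ofReal_one, zero_mulVec,
    dotProduct_zero, mul_zero, Complex.ofReal_zero, Complex.exp_zero, one_mul, map_one,
    one_apply_eq_self]

theorem map_toEuclideanCLM_volume {A : Matrix ι ι ℝ} (hA : IsUnit A.det) :
    (volume : Measure (Config ι)).map (toEuclideanCLM (𝕜 := ℝ) A) =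
      ENNReal.ofReal |A.det|⁻¹ • volume := by
  have det_eq : LinearMap.det A.toEuclideanLin = A.det := by
    rw [toEuclideanLin_eq_toLin_orthonormal, LinearMap.det_toLin]
  rw [← ContinuousLinearMap.coe_coe, coe_toEuclideanCLM_eq_toEuclideanLin,
    Measure.map_linearMap_addHaar_eq_smul_addHaar _ (det_eq ▸ hA.ne_zero), det_eq, abs_inv]

variable {A : Matrix ι ι ℝ} (hA : IsUnit A.det) (Q : Matrix ι ι ℝ)

include hA in
theorem quasiMeasurePreserving_toEuclideanCLM :
    Measure.QuasiMeasurePreserving (toEuclideanCLM (𝕜 := ℝ) A) (volume : Measure (Config ι))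
      volume :=
  ⟨(toEuclideanCLM (𝕜 := ℝ) A).measurable, by
    rw [map_toEuclideanCLM_volume hA]
    exact Measure.smul_absolutelyContinuous⟩

include hA in
theorem shearFun_congr_ae {f g : Config ι → ℂ} (h : f =ᵐ[volume] g) :
    shearFun A Q f =ᵐ[volume] shearFun A Q g := by
  filter_upwards [(quasiMeasurePreserving_toEuclideanCLM hA).ae h] with x hx
  simp only [shearFun, hx]

include hA in
theorem eLpNorm_shearFun {f : Config ι → ℂ} (hf : AEStronglyMeasurable f volume) :
    eLpNorm (shearFun A Q f) 2 volume = eLpNorm f 2 volume := by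
  have hpos : 0 < |A.det| := abs_pos.2 hA.ne_zero
  have normalization :
      ‖(Real.sqrt |A.det| : ℂ)‖ₑ * ENNReal.ofReal |A.det|⁻¹ ^ (1 / 2 : ℝ≥0∞).toReal = 1 := by
    rw [← ofReal_norm, Complex.norm_real, Real.norm_of_nonneg (Real.sqrt_nonneg _),
      ENNReal.ofReal_rpow_of_pos (by positivity), ← ENNReal.ofReal_mul (Real.sqrt_nonneg _),
      ENNReal.toReal_div, ENNReal.toReal_one, ENNReal.toReal_ofNat, ← Real.sqrt_eq_rpow,
      ← Real.sqrt_mul hpos.le, mul_inv_cancel₀ hpos.ne', Real.sqrt_one, ENNReal.ofReal_one]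
  have substitution : eLpNorm (fun x => f (toEuclideanCLM (𝕜 := ℝ) A x)) 2 volume =
      ENNReal.ofReal |A.det|⁻¹ ^ (1 / 2 : ℝ≥0∞).toReal * eLpNorm f 2 volume := by
    rw [← smul_eq_mul, ← eLpNorm_smul_measure_of_ne_top ENNReal.ofNat_ne_top,
      ← map_toEuclideanCLM_volume hA,
      eLpNorm_map_measure _ (toEuclideanCLM (𝕜 := ℝ) A).measurable.aemeasurable]
    · rfl
    · rw [map_toEuclideanCLM_volume hA]
      exact hf.smul_measure _
  calc eLpNorm (shearFun A Q f) 2 volume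
      = eLpNorm ((Real.sqrt |A.det| : ℂ) • fun x => f (toEuclideanCLM (𝕜 := ℝ) A x)) 2 volume :=
        eLpNorm_congr_norm_ae (.of_forall fun x => norm_shearFun A Q f x)
    _ = eLpNorm f 2 volume := by
        rw [eLpNorm_const_smul, substitution, ← mul_assoc, normalization, one_mul]

include hA in
theorem memLp_shearFun (ψ : ModeSpace ι) :
    MemLp (shearFun A Q ψ) 2 (volume : Measure (Config ι)) := by
  refine ⟨?_, by rw [eLpNorm_shearFun hA Q (Lp.aestronglyMeasurable ψ)]; exact Lp.eLpNorm_lt_top ψ⟩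
  have continuous_chirp : Continuous fun x : Config ι =>
      Complex.exp (Complex.I * ((1 / 2 * (x.ofLp ⬝ᵥ Q *ᵥ x.ofLp) : ℝ) : ℂ)) := by
    simp only [dotProduct, mulVec]
    fun_prop
  exact aestronglyMeasurable_const.mul (continuous_chirp.aestronglyMeasurable.mul
    ((Lp.aestronglyMeasurable ψ).comp_quasiMeasurePreserving
      (quasiMeasurePreserving_toEuclideanCLM hA)))

/-- The unitary `ψ ↦ √|det A| exp (i xᵀQx / 2) ψ (A x)`, as a linear isometry. -/
def shearIsometry : ModeSpace ι →ₗᵢ[ℂ] ModeSpace ι where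
  toFun ψ := (memLp_shearFun hA Q ψ).toLp (shearFun A Q ψ)
  map_add' ψ φ := by
    rw [← MemLp.toLp_add, MemLp.toLp_eq_toLp_iff, ← shearFun_add]
    exact shearFun_congr_ae hA Q (Lp.coeFn_add ψ φ)
  map_smul' c ψ := by
    rw [RingHom.id_apply, ← MemLp.toLp_const_smul, MemLp.toLp_eq_toLp_iff, ← shearFun_smul]
    exact shearFun_congr_ae hA Q (Lp.coeFn_smul c ψ)
  norm_map' ψ := by
    change ‖(memLp_shearFun hA Q ψ).toLp (shearFun A Q ψ)‖ = _
    rw [Lp.norm_toLp, eLpNorm_shearFun hA Q (Lp.aestronglyMeasurable ψ), Lp.norm_def]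

theorem coeFn_shearIsometry (ψ : ModeSpace ι) :
    (shearIsometry hA Q ψ : Config ι → ℂ) =ᵐ[volume] shearFun A Q ψ :=
  (memLp_shearFun hA Q ψ).coeFn_toLp

theorem shearIsometry_surjective : Function.Surjective (shearIsometry hA Q) := fun ψ => by
  have hA' : IsUnit A⁻¹.det := isUnit_nonsing_inv_det A hA
  have inverse : shearFun A Q (shearFun A⁻¹ (-((A⁻¹)ᵀ * Q * A⁻¹)) ψ) = ψ := by
    rw [shearFun_shearFun, nonsing_inv_mul _ hA, Matrix.mul_neg, Matrix.neg_mul, Matrix.mul_assoc,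
      Matrix.mul_assoc, nonsing_inv_mul _ hA, Matrix.mul_one, ← Matrix.mul_assoc, ← transpose_mul,
      nonsing_inv_mul _ hA, transpose_one, Matrix.one_mul, add_neg_cancel, shearFun_one_zero]
  refine ⟨shearIsometry hA' (-((A⁻¹)ᵀ * Q * A⁻¹)) ψ, Lp.ext ?_⟩
  rw [← inverse]
  exact (coeFn_shearIsometry hA Q _).trans (shearFun_congr_ae hA Q (coeFn_shearIsometry hA' _ ψ))

/-- The unitary `ψ ↦ √|det A| exp (i xᵀQx / 2) ψ (A x)`. -/
def shearUnitary : ModeSpace ι ≃ₗᵢ[ℂ] ModeSpace ι :=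
  LinearIsometryEquiv.ofSurjective (shearIsometry hA Q) (shearIsometry_surjective hA Q)

theorem coeFn_shearUnitary (ψ : ModeSpace ι) :
    (shearUnitary hA Q ψ : Config ι → ℂ) =ᵐ[volume] shearFun A Q ψ :=
  coeFn_shearIsometry hA Q ψ

variable {Q}

theorem transpose_shearMatrix_mulVec (hQ : Qᵀ = Q) (a b : ι → ℝ) :
    (shearMatrix A Q)ᵀ *ᵥ Sum.elim a b = Sum.elim ((A⁻¹)ᵀ *ᵥ (a + Q *ᵥ b)) (A *ᵥ b) := by
  simp only [shearMatrix, fromBlocks_transpose, fromBlocks_mulVec, transpose_mul, hQ,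
    transpose_zero, zero_mulVec, zero_add, transpose_transpose, mulVec_add, mulVec_mulVec,
    Sum.elim_comp_inl, Sum.elim_comp_inr]

include hA in
theorem weylFun_shearFun (hQ : Qᵀ = Q) (ξ : ι ⊕ ι → ℝ) (f : Config ι → ℂ) :
    weylFun ξ (shearFun A Q f) = shearFun A Q (weylFun ((shearMatrix A Q)ᵀ *ᵥ ξ) f) := by
  ext x
  obtain ⟨a, b, rfl⟩ : ∃ a b : ι → ℝ, ξ = Sum.elim a b := ⟨_, _, (Sum.elim_comp_inl_inr ξ).symm⟩
  have linear (y : ι → ℝ) :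
      ((A⁻¹)ᵀ *ᵥ (a + Q *ᵥ b)) ⬝ᵥ A *ᵥ y = a ⬝ᵥ y + b ⬝ᵥ Q *ᵥ y := by
    rw [dotProduct_mulVec, ← mulVec_transpose, mulVec_mulVec, ← transpose_mul,
      nonsing_inv_mul _ hA, transpose_one, one_mulVec, add_dotProduct, dotProduct_mulVec b,
      ← mulVec_transpose, hQ]
  have quadratic : (x.ofLp + b) ⬝ᵥ Q *ᵥ (x.ofLp + b) =
      x.ofLp ⬝ᵥ Q *ᵥ x.ofLp + 2 * (b ⬝ᵥ Q *ᵥ x.ofLp) + b ⬝ᵥ Q *ᵥ b := by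
    have symmetric : x.ofLp ⬝ᵥ Q *ᵥ b = b ⬝ᵥ Q *ᵥ x.ofLp := by
      rw [dotProduct_mulVec, ← mulVec_transpose, hQ, dotProduct_comm]
    rw [mulVec_add, dotProduct_add, add_dotProduct, add_dotProduct, symmetric]
    ring
  rw [transpose_shearMatrix_mulVec hQ, weylFun_elim]
  simp only [shearFun, weylFun_elim, map_add, toEuclideanCLM_toLp, ofLp_toEuclideanCLM,
    WithLp.ofLp_add, linear, quadratic]
  simp only [← mul_assoc, mul_comm _ (Real.sqrt |A.det| : ℂ)]
  simp only [mul_assoc _ (Complex.exp _) (Complex.exp _), ← Complex.exp_add, ← mul_add,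
    ← Complex.ofReal_add]
  ring_nf

theorem implements_shearUnitary (hQ : Qᵀ = Q) :
    Implements (shearUnitary hA Q) (shearMatrix A Q) 0 := by
  intro ξ φ
  rw [dotProduct_zero, Complex.ofReal_zero, mul_zero, Complex.exp_zero, one_smul]
  refine weyl_eq_of_ae (coeFn_shearUnitary hA Q φ) ?_
  rw [weylFun_shearFun hA hQ]
  exact (coeFn_shearUnitary hA Q _).trans (shearFun_congr_ae hA Q (coeFn_weyl _ φ))

theorem isGaussianUnitary_shearUnitary (hQ : Qᵀ = Q) : IsGaussianUnitary (shearUnitary hA Q) :=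
  ⟨_, shearMatrix_mem_symplecticGroup hA hQ, 0, implements_shearUnitary hA hQ⟩

end ShearUnitary

/-! ### Product vectors -/

section ProductVectors

variable {ι : Type} {k : ℕ} (P : ι → Fin k)

/-- The coordinates of a configuration that belong to the part `j`. -/
abbrev part (x : Config ι) (j : Fin k) : Config (ModesOf P j) :=
  WithLp.toLp 2 fun i : ModesOf P j => x i.1

/-- The configurations of all modes, as families of configurations of the parts. -/
def partsEquiv : Config ι ≃ᵐ ((j : Fin k) → Config (ModesOf P j)) where
  toFun := part P
  invFun y := WithLp.toLp 2 fun i => y (P i) ⟨i, rfl⟩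
  left_inv _ := rfl
  right_inv y := by
    ext j ⟨i, rfl⟩
    rfl
  measurable_toFun := by
    change Measurable (part P)
    fun_prop
  measurable_invFun := by
    change Measurable fun y : (j : Fin k) → Config (ModesOf P j) =>
      (WithLp.toLp 2 fun i => y (P i) ⟨i, rfl⟩ : Config ι)
    fun_prop

variable [Fintype ι]

theorem measurePreserving_glue :
    MeasurePreserving (fun (y : (j : Fin k) → ModesOf P j → ℝ) (i : ι) => y (P i) ⟨i, rfl⟩)
      (Measure.pi fun j => (volume : Measure (ModesOf P j → ℝ))) volume := by
  have measurable_glue :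
      Measurable fun (y : (j : Fin k) → ModesOf P j → ℝ) (i : ι) => y (P i) ⟨i, rfl⟩ := by
    fun_prop
  refine ⟨measurable_glue, ?_⟩
  rw [volume_pi (α := fun _ : ι => ℝ)]
  refine (Measure.pi_eq fun s hs => ?_).symm
  have preimage_box :
      (fun (y : (j : Fin k) → ModesOf P j → ℝ) (i : ι) => y (P i) ⟨i, rfl⟩) ⁻¹' Set.univ.pi s =
        Set.univ.pi fun j => Set.univ.pi fun i : ModesOf P j => s i.1 := by
    ext y
    simp only [Set.mem_preimage, Set.mem_univ_pi]
    exact ⟨fun h j ⟨i, hi⟩ => by subst hi; exact h i, fun h i => h (P i) ⟨i, rfl⟩⟩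
  rw [Measure.map_apply measurable_glue (MeasurableSet.univ_pi hs), preimage_box, Measure.pi_pi,
    ← Fintype.prod_fiberwise P]
  exact Finset.prod_congr rfl fun j _ => by rw [volume_pi, Measure.pi_pi]

theorem measurePreserving_partsEquiv :
    MeasurePreserving (partsEquiv P) volume
      (Measure.pi fun j => (volume : Measure (Config (ModesOf P j)))) := by
  have inverse : MeasurePreserving (partsEquiv P).symm
      (Measure.pi fun j => (volume : Measure (Config (ModesOf P j)))) volume :=
    (PiLp.volume_preserving_toLp ι).comp ((measurePreserving_glue P).comp
      (measurePreserving_pi _ _ fun j => PiLp.volume_preserving_ofLp (ModesOf P j)))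
  exact inverse.symm

theorem memLp_prod_part (φ : (j : Fin k) → ModeSpace (ModesOf P j)) :
    MemLp (fun x : Config ι => ∏ j, φ j (part P x j)) 2 volume := by
  have measurable_prod : AEStronglyMeasurable
      (fun y : (j : Fin k) → Config (ModesOf P j) => ∏ j, φ j (y j))
      (Measure.pi fun j => (volume : Measure (Config (ModesOf P j)))) :=
    Finset.aestronglyMeasurable_fun_prod _ fun j _ =>
      (Lp.aestronglyMeasurable (φ j)).comp_quasiMeasurePreserving
        (Measure.quasiMeasurePreserving_eval _ j)
  have memLp_prod : MemLp (fun y : (j : Fin k) → Config (ModesOf P j) => ∏ j, φ j (y j)) 2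
      (Measure.pi fun j => (volume : Measure (Config (ModesOf P j)))) := by
    refine (memLp_two_iff_integrable_sq_norm measurable_prod).2 ?_
    simp only [norm_prod, ← Finset.prod_pow]
    exact Integrable.fintype_prod_dep fun j =>
      (Lp.memLp (φ j)).integrable_norm_pow two_ne_zero
  exact memLp_prod.comp_measurePreserving (measurePreserving_partsEquiv P)

/-- The product vector `⨂ j, φ j`. -/
def productVec (φ : (j : Fin k) → ModeSpace (ModesOf P j)) : ModeSpace ι :=
  (memLp_prod_part P φ).toLp _

theorem coeFn_productVec (φ : (j : Fin k) → ModeSpace (ModesOf P j)) :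
    (productVec P φ : Config ι → ℂ) =ᵐ[volume] fun x => ∏ j, φ j (part P x j) :=
  MemLp.coeFn_toLp _

variable {P}

theorem isProductOf_iff {φ : (j : Fin k) → ModeSpace (ModesOf P j)} {Ψ : ModeSpace ι} :
    IsProductOf P φ Ψ ↔ Ψ = productVec P φ :=
  ⟨fun h => Lp.ext (h.trans (coeFn_productVec P φ).symm), fun h => h ▸ coeFn_productVec P φ⟩

theorem ae_part {p : (j : Fin k) → Config (ModesOf P j) → Prop} (h : ∀ j, ∀ᵐ y, p j y) :
    ∀ᵐ x : Config ι, ∀ j, p j (part P x j) :=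
  ae_all_iff.2 fun j => ((Measure.quasiMeasurePreserving_eval
    (fun j => (volume : Measure (Config (ModesOf P j)))) j).comp
      (measurePreserving_partsEquiv P).quasiMeasurePreserving).ae (h j)

theorem productVec_eq_of_ae {φ : (j : Fin k) → ModeSpace (ModesOf P j)}
    {f : (j : Fin k) → Config (ModesOf P j) → ℂ} (h : ∀ j, (φ j : _ → ℂ) =ᵐ[volume] f j)
    {Ψ : ModeSpace ι} (hΨ : (Ψ : Config ι → ℂ) =ᵐ[volume] fun x => ∏ j, f j (part P x j)) :
    productVec P φ = Ψ := by
  refine Lp.ext ((coeFn_productVec P φ).trans (Filter.EventuallyEq.trans ?_ hΨ.symm))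
  filter_upwards [ae_part h] with x hx
  exact Finset.prod_congr rfl fun j _ => hx j

theorem inner_productVec (φ φ' : (j : Fin k) → ModeSpace (ModesOf P j)) :
    inner ℂ (productVec P φ) (productVec P φ') = ∏ j, inner ℂ (φ j) (φ' j) := by
  calc inner ℂ (productVec P φ) (productVec P φ')
      = ∫ x : Config ι, ∏ j, inner ℂ (φ j (part P x j)) (φ' j (part P x j)) := by
        rw [L2.inner_def]
        refine integral_congr_ae ?_
        filter_upwards [coeFn_productVec P φ, coeFn_productVec P φ'] with x hx hx'
        simp only [hx, hx', RCLike.inner_apply, map_prod, Finset.prod_mul_distrib]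
    _ = ∫ y : (j : Fin k) → Config (ModesOf P j), ∏ j, inner ℂ (φ j (y j)) (φ' j (y j))
          ∂Measure.pi fun _ => volume :=
        (measurePreserving_partsEquiv P).integral_comp'
          (g := fun y => ∏ j, inner ℂ (φ j (y j)) (φ' j (y j)))
    _ = ∏ j, inner ℂ (φ j) (φ' j) := by
        rw [integral_fintype_prod_eq_prod fun j y => inner ℂ (φ j y) (φ' j y)]
        simp only [L2.inner_def]

theorem productVec_smul (c : Fin k → ℂ) (φ : (j : Fin k) → ModeSpace (ModesOf P j)) :
    productVec P (fun j => c j • φ j) = (∏ j, c j) • productVec P φ := by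
  refine productVec_eq_of_ae (fun j => Lp.coeFn_smul (c j) (φ j)) ?_
  filter_upwards [Lp.coeFn_smul (∏ j, c j) (productVec P φ), coeFn_productVec P φ] with x h₁ h₂
  simp only [h₁, h₂, Pi.smul_apply, smul_eq_mul, Finset.prod_mul_distrib]

/-- The restriction of a phase space vector to the quadratures of the part `j`. -/
def phasePart (P : ι → Fin k) (ξ : ι ⊕ ι → ℝ) (j : Fin k) : ModesOf P j ⊕ ModesOf P j → ℝ :=
  fun x => ξ (Sum.map Subtype.val Subtype.val x)

theorem weyl_productVec (ξ : ι ⊕ ι → ℝ) (φ : (j : Fin k) → ModeSpace (ModesOf P j)) :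
    weyl ξ (productVec P φ) = productVec P fun j => weyl (phasePart P ξ j) (φ j) := by
  refine weyl_eq_of_ae (coeFn_productVec P φ) ((coeFn_productVec P _).trans ?_)
  filter_upwards [ae_part (P := P) fun j => coeFn_weyl (phasePart P ξ j) (φ j)] with x hx
  rw [Finset.prod_congr rfl fun j _ => hx j]
  simp only [weylFun, Finset.prod_mul_distrib, ← Complex.exp_sum, ← Finset.mul_sum,
    ← Complex.ofReal_sum]
  simp only [Finset.sum_add_distrib, ← Finset.mul_sum]
  rw [← Fintype.sum_fiberwise P fun i => ξ (Sum.inl i) * x i,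
    ← Fintype.sum_fiberwise P fun i => ξ (Sum.inl i) * ξ (Sum.inr i)]
  rfl

theorem IsBlockDiagonal.mulVec_apply {A : Matrix ι ι ℝ} (hA : IsBlockDiagonal P A) (v : ι → ℝ)
    {j : Fin k} (i : ModesOf P j) :
    (A *ᵥ v) i.1 = (A.toSquareBlock P j *ᵥ fun i : ModesOf P j => v i.1) i := by
  rw [mulVec, dotProduct, ← Fintype.sum_fiberwise P,
    Finset.sum_eq_single_of_mem j (Finset.mem_univ j) fun l _ hl => ?_]
  · rfl
  · refine Finset.sum_eq_zero fun i' _ => ?_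
    rw [hA (i.2.trans_ne (i'.2.symm ▸ hl.symm)), zero_mul]

section Blocks

variable [DecidableEq ι] {A Q : Matrix ι ι ℝ}

theorem IsBlockDiagonal.det_eq_prod (hA : IsBlockDiagonal P A) :
    A.det = ∏ j, (A.toSquareBlock P j).det :=
  BlockTriangular.det_fintype fun _ _ h => hA h.ne'

theorem IsBlockDiagonal.isUnit_det_toSquareBlock (hA : IsBlockDiagonal P A) (h : IsUnit A.det)
    (j : Fin k) : IsUnit (A.toSquareBlock P j).det := by
  rw [hA.det_eq_prod, IsUnit.prod_univ_iff] at h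
  exact h j

theorem shearFun_prod_part (hA : IsBlockDiagonal P A) (hQ : IsBlockDiagonal P Q)
    (f : (j : Fin k) → Config (ModesOf P j) → ℂ) (x : Config ι) :
    shearFun A Q (fun x => ∏ j, f j (part P x j)) x =
      ∏ j, shearFun (A.toSquareBlock P j) (Q.toSquareBlock P j) (f j) (part P x j) := by
  have quadratic : x.ofLp ⬝ᵥ Q *ᵥ x.ofLp =
      ∑ j, (part P x j).ofLp ⬝ᵥ Q.toSquareBlock P j *ᵥ (part P x j).ofLp := by
    rw [dotProduct, ← Fintype.sum_fiberwise P]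
    refine Finset.sum_congr rfl fun j _ => Finset.sum_congr rfl fun i _ => ?_
    rw [hQ.mulVec_apply]
  have linear (j : Fin k) : part P (toEuclideanCLM (𝕜 := ℝ) A x) j =
      toEuclideanCLM (𝕜 := ℝ) (A.toSquareBlock P j) (part P x j) := by
    ext i
    exact hA.mulVec_apply x.ofLp i
  simp only [shearFun, Finset.prod_mul_distrib, ← Complex.exp_sum, ← Finset.mul_sum,
    ← Complex.ofReal_sum, ← Complex.ofReal_prod, quadratic, linear, hA.det_eq_prod,
    Finset.abs_prod, Real.sqrt_prod _ fun _ _ => abs_nonneg _]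

theorem isLocalGaussianUnitary_shearUnitary (hA : IsUnit A.det) (hQ : Qᵀ = Q)
    (hAP : IsBlockDiagonal P A) (hQP : IsBlockDiagonal P Q) :
    IsLocalGaussianUnitary P (shearUnitary hA Q) := by
  refine ⟨fun j => shearUnitary (hAP.isUnit_det_toSquareBlock hA j) (Q.toSquareBlock P j),
    fun j => isGaussianUnitary_shearUnitary _ ?_, fun φ => ⟨productVec P φ, coeFn_productVec P φ,
      isProductOf_iff.2 (productVec_eq_of_ae (fun j => coeFn_shearUnitary _ _ (φ j)) ?_).symm⟩⟩
  · ext x y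
    exact congrFun₂ hQ x.1 y.1
  · exact (coeFn_shearUnitary hA Q _).trans
      ((shearFun_congr_ae hA Q (coeFn_productVec P φ)).trans
        (.of_forall fun x => shearFun_prod_part hAP hQP _ x))

end Blocks

end ProductVectors

/-! ### The vacuum and the density of product vectors -/

section FourierInjective

theorem ae_eq_zero_of_fourier_eq_zero {E F : Type*} [NormedAddCommGroup E] [InnerProductSpace ℝ E]
    [FiniteDimensional ℝ E] [MeasurableSpace E] [BorelSpace E] [NormedAddCommGroup F]
    [NormedSpace ℂ F] [CompleteSpace F] {f : E → F} (hf : Integrable f) (h : 𝓕 f = 0) :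
    f =ᵐ[volume] 0 := by
  have ker_embedding :=
    Lp.ker_toTemperedDistributionCLM_eq_bot (F := F) (μ := (volume : Measure E)) (p := 1)
  have zero_distribution : Lp.toTemperedDistributionCLM F (volume : Measure E) 1 hf.toL1 = 0 := by
    ext g
    calc Lp.toTemperedDistribution hf.toL1 g
        = ∫ x, g x • f x := by
          rw [Lp.toTemperedDistribution_apply]
          refine integral_congr_ae ?_
          filter_upwards [hf.coeFn_toL1] with x hx
          rw [hx]
      _ = ∫ x, 𝓕 (𝓕⁻ g) x • f x := by rw [FourierTransform.fourier_fourierInv_eq]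
      _ = ∫ x, 𝓕⁻ g x • 𝓕 f x := by
          rw [SchwartzMap.fourier_coe]
          exact (VectorFourier.integral_fourierIntegral_smul_eq_flip (L := innerₗ E)
            Real.continuous_fourierChar continuous_inner
            ((𝓕⁻ g).integrable (μ := volume)) hf).trans (by rw [flip_innerₗ]; rfl)
      _ = 0 := by simp only [h, Pi.zero_apply, smul_zero, integral_zero]
  have toL1_eq_zero := LinearMap.ker_eq_bot'.1 ker_embedding _ zero_distribution
  exact hf.coeFn_toL1.symm.trans (Lp.eq_zero_iff_ae_eq_zero.1 toL1_eq_zero)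

variable {ι : Type} [Fintype ι] {f g : Config ι → ℂ}

theorem fourier_eq_integral_exp (f : Config ι → ℂ) (w : Config ι) :
    𝓕 f w = ∫ x : Config ι,
      Complex.exp (Complex.I * (((-(2 * Real.pi)) • w.ofLp ⬝ᵥ x.ofLp : ℝ) : ℂ)) * f x := by
  rw [Real.fourier_eq]
  refine integral_congr_ae (.of_forall fun x => ?_)
  simp only [Circle.smul_def, Real.fourierChar_apply, smul_eq_mul,
    EuclideanSpace.inner_eq_star_dotProduct, star_trivial, smul_dotProduct, mul_neg, neg_mul,
    mul_comm Complex.I]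

theorem integrable_exp_mul (hf : Integrable f) (a : ι → ℝ) :
    Integrable fun x : Config ι => Complex.exp (Complex.I * ((a ⬝ᵥ x.ofLp : ℝ) : ℂ)) * f x := by
  refine hf.bdd_mul (c := 1) (Continuous.aestronglyMeasurable ?_) (.of_forall fun x => ?_)
  · simp only [dotProduct]
    fun_prop
  · rw [mul_comm Complex.I, Complex.norm_exp_ofReal_mul_I]

theorem ae_eq_of_integral_exp_eq (hf : Integrable f) (hg : Integrable g)
    (h : ∀ a : ι → ℝ, ∫ x : Config ι, Complex.exp (Complex.I * ((a ⬝ᵥ x.ofLp : ℝ) : ℂ)) * f x =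
      ∫ x : Config ι, Complex.exp (Complex.I * ((a ⬝ᵥ x.ofLp : ℝ) : ℂ)) * g x) :
    f =ᵐ[volume] g := by
  have fourier_sub : 𝓕 (f - g) = 0 := by
    ext w
    simp only [fourier_eq_integral_exp, Pi.sub_apply, mul_sub, Pi.zero_apply]
    rw [integral_sub (integrable_exp_mul hf _) (integrable_exp_mul hg _), h, sub_self]
  filter_upwards [ae_eq_zero_of_fourier_eq_zero (hf.sub hg) fourier_sub] with x hx
  exact sub_eq_zero.1 hx

end FourierInjective

section Vacuum

variable {ι : Type} [Fintype ι]

/-- The wave function of the ground state of the harmonic oscillator. -/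
def vacuumFun (x : Config ι) : ℝ :=
  Real.pi ^ (-(Fintype.card ι : ℝ) / 4) * Real.exp (-(1 / 2) * ‖x‖ ^ 2)

theorem vacuumFun_pos (x : Config ι) : 0 < vacuumFun x :=
  mul_pos (Real.rpow_pos_of_pos Real.pi_pos _) (Real.exp_pos _)

theorem vacuumFun_mul (x y : Config ι) : vacuumFun x * vacuumFun y =
    Real.pi ^ (-(Fintype.card ι : ℝ) / 2) * Real.exp (-(1 / 2) * (‖x‖ ^ 2 + ‖y‖ ^ 2)) := by
  rw [vacuumFun, vacuumFun, mul_mul_mul_comm, ← Real.rpow_add Real.pi_pos, ← Real.exp_add]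
  ring_nf

theorem vacuumFun_sq (x : Config ι) :
    vacuumFun x ^ 2 = Real.pi ^ (-(Fintype.card ι : ℝ) / 2) * Real.exp (-‖x‖ ^ 2) := by
  rw [sq, vacuumFun_mul]
  ring_nf

theorem integral_vacuumFun_sq : ∫ x : Config ι, vacuumFun x ^ 2 = 1 := by
  have gaussian := GaussianFourier.integral_rexp_neg_mul_sq_norm (V := Config ι) (b := 1) one_pos
  simp only [neg_mul, one_mul, div_one, finrank_euclideanSpace] at gaussian
  simp_rw [vacuumFun_sq]
  rw [integral_const_mul, gaussian, ← Real.rpow_add Real.pi_pos, neg_div, neg_add_cancel,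
    Real.rpow_zero]

theorem integrable_vacuumFun_sq : Integrable fun x : Config ι => vacuumFun x ^ 2 :=
  .of_integral_ne_zero (integral_vacuumFun_sq.trans_ne one_ne_zero)

theorem memLp_vacuumFun : MemLp (fun x : Config ι => (vacuumFun x : ℂ)) 2 volume := by
  have measurable : AEStronglyMeasurable (fun x : Config ι => (vacuumFun x : ℂ)) volume := by
    unfold vacuumFun
    fun_prop
  refine (memLp_two_iff_integrable_sq_norm measurable).2 ?_
  simpa only [Complex.norm_real, Real.norm_eq_abs, sq_abs] using integrable_vacuumFun_sq

variable (ι) in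
/-- The ground state of the harmonic Hamiltonian. -/
def vacuum : ModeSpace ι := memLp_vacuumFun.toLp _

theorem coeFn_vacuum : (vacuum ι : Config ι → ℂ) =ᵐ[volume] fun x => (vacuumFun x : ℂ) :=
  MemLp.coeFn_toLp _

theorem norm_vacuum : ‖vacuum ι‖ = 1 := by
  have inner_self : inner ℂ (vacuum ι) (vacuum ι) = (1 : ℂ) := calc
    inner ℂ (vacuum ι) (vacuum ι) = ∫ x : Config ι, ((vacuumFun x ^ 2 : ℝ) : ℂ) := by
      rw [L2.inner_def]
      refine integral_congr_ae ?_
      filter_upwards [coeFn_vacuum (ι := ι)] with x hx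
      rw [hx, RCLike.inner_apply, Complex.conj_ofReal, sq, Complex.ofReal_mul]
    _ = 1 := by rw [integral_complex_ofReal, integral_vacuumFun_sq, Complex.ofReal_one]
  exact (pow_eq_one_iff_of_nonneg (norm_nonneg _) two_ne_zero).1
    (by rw [← inner_self_eq_norm_sq (𝕜 := ℂ), inner_self, RCLike.one_re])

variable {k : ℕ} (P : ι → Fin k)

theorem vacuumFun_eq_prod (x : Config ι) : vacuumFun x = ∏ j, vacuumFun (part P x j) := by
  simp only [vacuumFun, Finset.prod_mul_distrib, ← Real.exp_sum, EuclideanSpace.real_norm_sq_eq]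
  congr 1
  · rw [← Real.rpow_sum_of_pos Real.pi_pos, ← Finset.sum_div, Finset.sum_neg_distrib]
    congr 3
    simpa only [Finset.sum_const, Finset.card_univ, nsmul_eq_mul, mul_one] using
      (Fintype.sum_fiberwise P fun _ => (1 : ℝ)).symm
  · rw [← Finset.mul_sum, ← Fintype.sum_fiberwise P]

theorem productVec_vacuum : productVec P (fun j => vacuum (ModesOf P j)) = vacuum ι :=
  productVec_eq_of_ae (fun _ => coeFn_vacuum) (coeFn_vacuum.trans (.of_forall fun x =>
    (congrArg _ (vacuumFun_eq_prod P x)).trans (Complex.ofReal_prod _ _)))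

theorem eq_zero_of_inner_weyl_vacuum_eq_zero {Ψ : ModeSpace ι}
    (h : ∀ a : ι → ℝ, inner ℂ Ψ (weyl (Sum.elim a 0) (vacuum ι)) = 0) : Ψ = 0 := by
  have integrable : Integrable fun x : Config ι => vacuum ι x * starRingEnd ℂ (Ψ x) :=
    L2.integrable_inner Ψ (vacuum ι)
  have product_eq_zero := ae_eq_of_integral_exp_eq integrable (integrable_zero _ _ _) fun a => by
    have inner_eq_zero := h a
    simp only [inner_weyl, weylFun_elim_zero_right, mul_assoc] at inner_eq_zero
    simp only [inner_eq_zero, Pi.zero_apply, mul_zero, integral_zero]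
  refine (Lp.eq_zero_iff_ae_eq_zero).2 ?_
  filter_upwards [product_eq_zero, coeFn_vacuum (ι := ι)] with x hx hv
  rw [hv] at hx
  simpa using (mul_eq_zero.1 hx).resolve_left (Complex.ofReal_ne_zero.2 (vacuumFun_pos x).ne')

theorem dense_span_productVec :
    (Submodule.span ℂ (Set.range (productVec P))).topologicalClosure = ⊤ := by
  rw [Submodule.topologicalClosure_eq_top_iff, Submodule.eq_bot_iff]
  intro Ψ hΨ
  refine eq_zero_of_inner_weyl_vacuum_eq_zero fun a => ?_
  refine (Submodule.mem_orthogonal' _ _).1 hΨ _ (Submodule.subset_span ?_)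
  rw [← productVec_vacuum P, weyl_productVec]
  exact Set.mem_range_self _

end Vacuum

/-! ### Local unitaries act by block diagonal symplectic matrices -/

section Local

variable {ι : Type} {k : ℕ} (P : ι → Fin k)

/-- The quadratures grouped by parts. -/
def phaseEquiv : ι ⊕ ι ≃ (j : Fin k) × (ModesOf P j ⊕ ModesOf P j) where
  toFun := Sum.elim (fun i => ⟨P i, Sum.inl ⟨i, rfl⟩⟩) fun i => ⟨P i, Sum.inr ⟨i, rfl⟩⟩
  invFun y := Sum.map Subtype.val Subtype.val y.2
  left_inv := by rintro (x | x) <;> rfl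
  right_inv := by rintro ⟨_, ⟨x, rfl⟩ | ⟨x, rfl⟩⟩ <;> rfl

theorem phaseEquiv_fst (x : ι ⊕ ι) : (phaseEquiv P x).1 = Sum.elim P P x := by
  cases x <;> rfl

theorem dotProduct_eq_sum_phasePart [Fintype ι] (ξ D : ι ⊕ ι → ℝ) :
    ξ ⬝ᵥ D = ∑ j, phasePart P ξ j ⬝ᵥ phasePart P D j := by
  rw [dotProduct, ← (phaseEquiv P).symm.sum_comp, Fintype.sum_sigma]
  rfl

theorem exists_phasePart_eq (d : (j : Fin k) → ModesOf P j ⊕ ModesOf P j → ℝ) :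
    ∃ D : ι ⊕ ι → ℝ, phasePart P D = d := by
  refine ⟨fun x => d _ (phaseEquiv P x).2, ?_⟩
  ext j (⟨i, rfl⟩ | ⟨i, rfl⟩) <;> rfl

/-- The phase space matrix with diagonal blocks `S j` on the quadratures of the parts. -/
def assemble (S : (j : Fin k) → PhaseMatrix (ModesOf P j)) : PhaseMatrix ι :=
  (blockDiagonal' S).submatrix (phaseEquiv P) (phaseEquiv P)

theorem isBlockDiagonal_assemble (S : (j : Fin k) → PhaseMatrix (ModesOf P j)) :
    IsBlockDiagonal (Sum.elim P P) (assemble P S) := fun x y h =>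
  blockDiagonal'_apply_ne S _ _ ((phaseEquiv_fst P x).trans_ne (h.trans_eq
    (phaseEquiv_fst P y).symm))

theorem assemble_J [DecidableEq ι] : assemble P (fun j => J (ModesOf P j) ℝ) = J ι ℝ := by
  have block : blockDiagonal' (fun j => J (ModesOf P j) ℝ) =
      (J ι ℝ).submatrix (phaseEquiv P).symm (phaseEquiv P).symm := by
    ext ⟨j, x⟩ ⟨l, y⟩
    by_cases h : j = l
    · subst h
      rw [blockDiagonal'_apply_eq]
      rcases x with x | x <;> rcases y with y | y <;>
        simp [J, phaseEquiv, one_apply, Subtype.ext_iff]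
    · rw [blockDiagonal'_apply_ne _ _ _ h, submatrix_apply]
      refine (isBlockDiagonal_J P ?_).symm
      rw [← phaseEquiv_fst, ← phaseEquiv_fst, Equiv.apply_symm_apply, Equiv.apply_symm_apply]
      exact h
  rw [assemble, block, submatrix_submatrix, Equiv.symm_comp_self, submatrix_id_id]

variable [Fintype ι] {P}

theorem assemble_mem_localSymplecticGroup [DecidableEq ι]
    {S : (j : Fin k) → PhaseMatrix (ModesOf P j)}
    (hS : ∀ j, S j ∈ symplecticGroup (ModesOf P j) ℝ) :
    assemble P S ∈ localSymplecticGroup P := by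
  refine ⟨?_, isBlockDiagonal_assemble P S⟩
  simp only [SymplecticGroup.mem_iff] at hS
  rw [SymplecticGroup.mem_iff, ← assemble_J P]
  simp only [assemble, transpose_submatrix, submatrix_mul_equiv, blockDiagonal'_transpose,
    ← blockDiagonal'_mul, hS]

theorem phasePart_assemble_transpose_mulVec (S : (j : Fin k) → PhaseMatrix (ModesOf P j))
    (ξ : ι ⊕ ι → ℝ) (j : Fin k) :
    phasePart P ((assemble P S)ᵀ *ᵥ ξ) j = (S j)ᵀ *ᵥ phasePart P ξ j := by
  ext x
  have hx : phaseEquiv P (Sum.map Subtype.val Subtype.val x) = ⟨j, x⟩ :=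
    (phaseEquiv P).apply_symm_apply ⟨j, x⟩
  simp only [phasePart, mulVec, dotProduct, transpose_apply, assemble, submatrix_apply, hx]
  rw [← (phaseEquiv P).symm.sum_comp, Fintype.sum_sigma,
    Finset.sum_eq_single_of_mem j (Finset.mem_univ j) fun l _ hl =>
      Finset.sum_eq_zero fun y _ => ?_]
  · refine Finset.sum_congr rfl fun y _ => ?_
    rw [Equiv.apply_symm_apply, blockDiagonal'_apply_eq]
    rfl
  · rw [Equiv.apply_symm_apply, blockDiagonal'_apply_ne _ _ _ hl, zero_mul]

theorem ext_productVec {T T' : ModeSpace ι →L[ℂ] ModeSpace ι}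
    (h : ∀ φ, T (productVec P φ) = T' (productVec P φ)) : T = T' :=
  ContinuousLinearMap.ext_on
    (Submodule.dense_iff_topologicalClosure_eq_top.2 (dense_span_productVec P))
    (Set.forall_mem_range.2 h)

theorem IsLocalGaussianUnitary.exists_implements [DecidableEq ι]
    {U : ModeSpace ι ≃ₗᵢ[ℂ] ModeSpace ι}
    (hU : IsLocalGaussianUnitary P U) : ∃ S ∈ localSymplecticGroup P, ∃ d, Implements U S d := by
  obtain ⟨u, hu, hprod⟩ := hU
  choose S hS d hd using hu
  obtain ⟨D, hD⟩ := exists_phasePart_eq P d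
  have map_productVec (φ : (j : Fin k) → ModeSpace (ModesOf P j)) :
      U (productVec P φ) = productVec P fun j => u j (φ j) := by
    obtain ⟨Ψ, hΨ, hUΨ⟩ := hprod φ
    rw [← isProductOf_iff.1 hΨ, ← isProductOf_iff.1 hUΨ]
  refine ⟨assemble P S, assemble_mem_localSymplecticGroup hS, D, fun ξ Φ => ?_⟩
  let c : ℂ := Complex.exp (Complex.I * ((ξ ⬝ᵥ D : ℝ) : ℂ))
  have c_eq_prod : c = ∏ j, Complex.exp (Complex.I * ((phasePart P ξ j ⬝ᵥ d j : ℝ) : ℂ)) := by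
    rw [← Complex.exp_sum, ← Finset.mul_sum, ← Complex.ofReal_sum, ← hD,
      ← dotProduct_eq_sum_phasePart P]
  let u' : ModeSpace ι →L[ℂ] ModeSpace ι := U.toContinuousLinearEquiv
  have intertwine : (weylIsometry ξ).toContinuousLinearMap ∘L u' =
      c • u' ∘L (weylIsometry ((assemble P S)ᵀ *ᵥ ξ)).toContinuousLinearMap := by
    refine ext_productVec (P := P) fun φ => ?_
    change weyl ξ (U (productVec P φ)) = c • U (weyl _ (productVec P φ))
    rw [map_productVec, weyl_productVec, weyl_productVec, map_productVec, c_eq_prod,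
      ← productVec_smul]
    simp only [phasePart_assemble_transpose_mulVec]
    exact congrArg (productVec P) (funext fun j => hd j _ _)
  exact congrArg (fun T => T Φ) intertwine

end Local

/-! ### Purity -/

section Purity

variable {ι : Type} [Fintype ι]

theorem norm_sq_eq_dotProduct (x : Config ι) : ‖x‖ ^ 2 = x.ofLp ⬝ᵥ x.ofLp := by
  rw [← real_inner_self_eq_norm_sq, EuclideanSpace.inner_eq_star_dotProduct, star_trivial]

theorem integral_exp_mul_vacuumFun_sq (a : ι → ℝ) :
    ∫ x : Config ι, Complex.exp (Complex.I * ((a ⬝ᵥ x.ofLp : ℝ) : ℂ)) *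
      ((vacuumFun x ^ 2 : ℝ) : ℂ) = ((Real.exp (-(1 / 4) * (a ⬝ᵥ a)) : ℝ) : ℂ) := by
  have gaussian := GaussianFourier.integral_cexp_neg_mul_sq_norm_add (V := Config ι) (b := 1)
    (by simp) Complex.I (WithLp.toLp 2 a)
  have normalisation : ((Real.pi ^ (-(Fintype.card ι : ℝ) / 2) : ℝ) : ℂ) *
      ((Real.pi : ℂ) / 1) ^ ((Module.finrank ℝ (Config ι) : ℂ) / 2) = 1 := by
    rw [finrank_euclideanSpace, div_one, ← Complex.ofReal_natCast, ← Complex.ofReal_ofNat,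
      ← Complex.ofReal_div, ← Complex.ofReal_cpow Real.pi_pos.le, ← Complex.ofReal_mul,
      ← Real.rpow_add Real.pi_pos, neg_div, neg_add_cancel, Real.rpow_zero, Complex.ofReal_one]
  calc ∫ x : Config ι, Complex.exp (Complex.I * ((a ⬝ᵥ x.ofLp : ℝ) : ℂ)) *
        ((vacuumFun x ^ 2 : ℝ) : ℂ)
      = ((Real.pi ^ (-(Fintype.card ι : ℝ) / 2) : ℝ) : ℂ) * ∫ x : Config ι, Complex.exp
          (-1 * (‖x‖ : ℂ) ^ 2 + Complex.I * ((inner ℝ (WithLp.toLp 2 a) x : ℝ) : ℂ)) := by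
        rw [← integral_const_mul]
        refine integral_congr_ae (.of_forall fun x => ?_)
        simp only [vacuumFun_sq, Complex.ofReal_mul, Complex.ofReal_exp,
          EuclideanSpace.inner_eq_star_dotProduct, star_trivial, Complex.exp_add,
          dotProduct_comm a]
        push_cast
        ring_nf
    _ = Complex.exp (Complex.I ^ 2 * (‖(WithLp.toLp 2 a : Config ι)‖ : ℂ) ^ 2 / (4 * 1)) := by
        rw [gaussian, ← mul_assoc, normalisation, one_mul]
    _ = ((Real.exp (-(1 / 4) * (a ⬝ᵥ a)) : ℝ) : ℂ) := by
        rw [Complex.I_sq, ← Complex.ofReal_pow, norm_sq_eq_dotProduct, Complex.ofReal_exp]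
        push_cast
        ring_nf

/-- The correlation function `ψ (x + b) * conj (ψ x)` of a Gaussian state whose covariance matrix
is `fromBlocks 1 Y Yᵀ Z`. -/
def gaussKernel (Y Z : Matrix ι ι ℝ) (b : ι → ℝ) (x : Config ι) : ℂ :=
  ((Real.exp (1 / 4 * (Y *ᵥ b ⬝ᵥ Y *ᵥ b - b ⬝ᵥ Z *ᵥ b)) : ℝ) : ℂ) *
    (Complex.exp (Complex.I * ((Y *ᵥ b ⬝ᵥ (x + WithLp.toLp 2 ((1 / 2 : ℝ) • b)).ofLp : ℝ) : ℂ)) *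
      ((vacuumFun (x + WithLp.toLp 2 ((1 / 2 : ℝ) • b)) ^ 2 : ℝ) : ℂ))

theorem integrable_gaussKernel (Y Z : Matrix ι ι ℝ) (b : ι → ℝ) :
    Integrable (gaussKernel Y Z b) :=
  ((integrable_exp_mul integrable_vacuumFun_sq.ofReal (Y *ᵥ b)).comp_add_right _).const_mul _

theorem integral_exp_mul_gaussKernel (Y Z : Matrix ι ι ℝ) (a b : ι → ℝ) :
    ∫ x : Config ι, Complex.exp (Complex.I * ((a ⬝ᵥ x.ofLp + 1 / 2 * (a ⬝ᵥ b) : ℝ) : ℂ)) *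
        gaussKernel Y Z b x =
      ((Real.exp (-(1 / 4) * (a ⬝ᵥ a + 2 * (a ⬝ᵥ Y *ᵥ b) + b ⬝ᵥ Z *ᵥ b)) : ℝ) : ℂ) := by
  let f (v : Config ι) : ℂ := ((Real.exp (1 / 4 * (Y *ᵥ b ⬝ᵥ Y *ᵥ b - b ⬝ᵥ Z *ᵥ b)) : ℝ) : ℂ) *
    (Complex.exp (Complex.I * (((a + Y *ᵥ b) ⬝ᵥ v.ofLp : ℝ) : ℂ)) * ((vacuumFun v ^ 2 : ℝ) : ℂ))
  have recentre (x : Config ι) :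
      Complex.exp (Complex.I * ((a ⬝ᵥ x.ofLp + 1 / 2 * (a ⬝ᵥ b) : ℝ) : ℂ)) * gaussKernel Y Z b x =
        f (x + WithLp.toLp 2 ((1 / 2 : ℝ) • b)) := by
    simp only [f, gaussKernel, add_dotProduct, Complex.ofReal_add, mul_add, Complex.exp_add,
      WithLp.ofLp_add, dotProduct_add, dotProduct_smul, smul_eq_mul]
    ring
  rw [integral_congr_ae (.of_forall recentre), integral_add_right_eq_self f]
  rw [integral_const_mul, integral_exp_mul_vacuumFun_sq, ← Complex.ofReal_mul, ← Real.exp_add]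
  simp only [dotProduct_add, add_dotProduct, dotProduct_comm (Y *ᵥ b) a]
  ring_nf

theorem HasGaussianChar.ae_eq_gaussKernel [DecidableEq ι] {φ : ModeSpace ι} {Y Z : Matrix ι ι ℝ}
    (h : HasGaussianChar φ (fromBlocks 1 Y Yᵀ Z) 0) (b : ι → ℝ) :
    ∀ᵐ x : Config ι, φ (x + WithLp.toLp 2 b) * starRingEnd ℂ (φ x) = gaussKernel Y Z b x := by
  have memLp_shift : MemLp (fun x : Config ι => φ (x + WithLp.toLp 2 b)) 2 volume :=
    (Lp.memLp φ).comp_measurePreserving (measurePreserving_add_right volume _)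
  refine ae_eq_of_integral_exp_eq (memLp_shift.integrable_mul (Lp.memLp φ).star)
    (integrable_gaussKernel Y Z b) fun a => ?_
  have quadratic : Sum.elim a b ⬝ᵥ fromBlocks 1 Y Yᵀ Z *ᵥ Sum.elim a b =
      a ⬝ᵥ a + 2 * (a ⬝ᵥ Y *ᵥ b) + b ⬝ᵥ Z *ᵥ b := by
    rw [fromBlocks_mulVec, sumElim_dotProduct_sumElim]
    simp only [Sum.elim_comp_inl, Sum.elim_comp_inr, one_mulVec, dotProduct_add]
    rw [mulVec_transpose, dotProduct_comm b (a ᵥ* Y), ← dotProduct_mulVec]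
    ring
  have char_eq := hasGaussianChar_zero_iff.1 h (Sum.elim a b)
  rw [inner_weyl, quadratic, ← integral_exp_mul_gaussKernel] at char_eq
  simp only [weylFun_elim, Complex.ofReal_add, mul_add, Complex.exp_add, mul_assoc,
    mul_left_comm _ (Complex.exp (Complex.I * ((1 / 2 * (a ⬝ᵥ b) : ℝ) : ℂ))),
    integral_const_mul] at char_eq
  exact mul_left_cancel₀ (Complex.exp_ne_zero _) char_eq

theorem eq_and_exp_eq_one_of_mul_exp_eq {r s α β : ℝ} (hr : 0 < r) (hs : 0 < s)
    (h : (r : ℂ) * Complex.exp (Complex.I * (α : ℂ)) = s * Complex.exp (Complex.I * (β : ℂ))) :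
    r = s ∧ Complex.exp (Complex.I * ((α - β : ℝ) : ℂ)) = 1 := by
  obtain rfl : r = s := by
    simpa [mul_comm Complex.I, Complex.norm_exp_ofReal_mul_I, abs_of_pos hr, abs_of_pos hs] using
      congrArg norm h
  refine ⟨rfl, ?_⟩
  rw [Complex.ofReal_sub, mul_sub, Complex.exp_sub,
    mul_left_cancel₀ (Complex.ofReal_ne_zero.2 hr.ne') h, div_self (Complex.exp_ne_zero _)]

theorem gaussKernel_eq_ofReal_mul_exp (Y Z : Matrix ι ι ℝ) (b : ι → ℝ) (x : Config ι) :
    gaussKernel Y Z b x =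
      ((Real.pi ^ (-(Fintype.card ι : ℝ) / 2) *
        Real.exp (1 / 4 * (Y *ᵥ b ⬝ᵥ Y *ᵥ b - b ⬝ᵥ Z *ᵥ b) -
          (x.ofLp + (1 / 2 : ℝ) • b) ⬝ᵥ (x.ofLp + (1 / 2 : ℝ) • b)) : ℝ) : ℂ) *
      Complex.exp (Complex.I * ((Y *ᵥ b ⬝ᵥ (x.ofLp + (1 / 2 : ℝ) • b) : ℝ) : ℂ)) := by
  rw [gaussKernel, vacuumFun_sq, norm_sq_eq_dotProduct, WithLp.ofLp_add, WithLp.ofLp_toLp,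
    Real.exp_sub, Real.exp_neg, div_eq_mul_inv]
  push_cast
  ring

theorem gaussKernel_mul_gaussKernel (Y Z : Matrix ι ι ℝ) (b b' : ι → ℝ) (x x' : Config ι) :
    gaussKernel Y Z b x * gaussKernel Y Z b' x' =
      ((Real.pi ^ (-(Fintype.card ι : ℝ)) *
        Real.exp (1 / 4 * (Y *ᵥ b ⬝ᵥ Y *ᵥ b - b ⬝ᵥ Z *ᵥ b) -
          (x.ofLp + (1 / 2 : ℝ) • b) ⬝ᵥ (x.ofLp + (1 / 2 : ℝ) • b) +
          (1 / 4 * (Y *ᵥ b' ⬝ᵥ Y *ᵥ b' - b' ⬝ᵥ Z *ᵥ b') -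
            (x'.ofLp + (1 / 2 : ℝ) • b') ⬝ᵥ (x'.ofLp + (1 / 2 : ℝ) • b'))) : ℝ) : ℂ) *
      Complex.exp (Complex.I * ((Y *ᵥ b ⬝ᵥ (x.ofLp + (1 / 2 : ℝ) • b) +
        Y *ᵥ b' ⬝ᵥ (x'.ofLp + (1 / 2 : ℝ) • b') : ℝ) : ℂ)) := by
  rw [gaussKernel_eq_ofReal_mul_exp, gaussKernel_eq_ofReal_mul_exp, mul_mul_mul_comm,
    ← Complex.ofReal_mul, mul_mul_mul_comm, ← Real.rpow_add Real.pi_pos, ← Real.exp_add,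
    ← Complex.exp_add, ← mul_add, ← Complex.ofReal_add]
  ring_nf

theorem gaussKernel_cocycle {Y Z : Matrix ι ι ℝ} {b b' : ι → ℝ} {x : Config ι}
    (h : gaussKernel Y Z b x * gaussKernel Y Z b' (x + WithLp.toLp 2 b) =
      gaussKernel Y Z 0 (x + WithLp.toLp 2 b) * gaussKernel Y Z (b + b') x) :
    b ⬝ᵥ Z *ᵥ b' + b' ⬝ᵥ Z *ᵥ b = 2 * (b ⬝ᵥ b' + Y *ᵥ b ⬝ᵥ Y *ᵥ b') ∧
      Complex.exp (Complex.I * ((1 / 2 * (Y *ᵥ b' ⬝ᵥ b - Y *ᵥ b ⬝ᵥ b') : ℝ) : ℂ)) = 1 := by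
  rw [gaussKernel_mul_gaussKernel, gaussKernel_mul_gaussKernel] at h
  obtain ⟨modulus, phase⟩ := eq_and_exp_eq_one_of_mul_exp_eq (by positivity) (by positivity) h
  have exponent := Real.exp_injective (mul_left_cancel₀ (by positivity) modulus)
  simp only [WithLp.ofLp_add, mulVec_zero, mulVec_add, dotProduct_add, add_dotProduct,
    smul_dotProduct, dotProduct_smul, zero_dotProduct, smul_add, smul_zero, dotProduct_zero,
    smul_eq_mul, dotProduct_comm b x.ofLp, dotProduct_comm b' x.ofLp, dotProduct_comm b' b,
    dotProduct_comm (Y *ᵥ b') (Y *ᵥ b)] at exponent phase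
  refine ⟨by linarith, ?_⟩
  rw [← phase]
  congr 3
  ring

theorem HasGaussianChar.exists_gaussKernel_mul_eq [DecidableEq ι] {φ : ModeSpace ι}
    {Y Z : Matrix ι ι ℝ} (h : HasGaussianChar φ (fromBlocks 1 Y Yᵀ Z) 0) (b b' : ι → ℝ) :
    ∃ x : Config ι, gaussKernel Y Z b x * gaussKernel Y Z b' (x + WithLp.toLp 2 b) =
      gaussKernel Y Z 0 (x + WithLp.toLp 2 b) * gaussKernel Y Z (b + b') x := by
  obtain ⟨x, hb, hb', h0, hsum⟩ := ((h.ae_eq_gaussKernel b).and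
    ((ae_comp_add_right (h.ae_eq_gaussKernel b') (WithLp.toLp 2 b)).and
      ((ae_comp_add_right (h.ae_eq_gaussKernel 0) (WithLp.toLp 2 b)).and
        (h.ae_eq_gaussKernel (b + b'))))).exists
  rw [WithLp.toLp_zero, add_zero] at h0
  rw [add_assoc, ← WithLp.toLp_add 2 b b'] at hb'
  refine ⟨x, ?_⟩
  rw [← hb, ← hb', ← h0, ← hsum]
  ring

theorem HasGaussianChar.transpose_eq_and_eq_one_add [DecidableEq ι] {φ : ModeSpace ι}
    {Y Z : Matrix ι ι ℝ} (h : HasGaussianChar φ (fromBlocks 1 Y Yᵀ Z) 0) (hZ : Zᵀ = Z) :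
    Yᵀ = Y ∧ Z = 1 + Yᵀ * Y := by
  have cocycle b b' := gaussKernel_cocycle (h.exists_gaussKernel_mul_eq b b').choose_spec
  have Y_symm (b b' : ι → ℝ) : Y *ᵥ b' ⬝ᵥ b = Y *ᵥ b ⬝ᵥ b' := by
    -- otherwise rescaling `b` turns the phase into `exp (π i) = -1`
    by_contra hne
    have hd := sub_ne_zero.2 hne
    have phase := (cocycle ((2 * Real.pi / (Y *ᵥ b' ⬝ᵥ b - Y *ᵥ b ⬝ᵥ b')) • b) b').2
    rw [mulVec_smul, smul_dotProduct, dotProduct_smul, ← smul_sub, smul_eq_mul,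
      div_mul_cancel₀ _ hd, one_div, inv_mul_cancel_left₀ two_ne_zero, mul_comm,
      Complex.exp_pi_mul_I] at phase
    norm_num at phase
  constructor
  · ext i j
    simpa using Y_symm (Pi.single j 1) (Pi.single i 1)
  · ext i j
    have modulus := (cocycle (Pi.single i 1) (Pi.single j 1)).1
    have Z_symm : Z j i = Z i j := congrFun (congrFun hZ i) j
    simp only [mulVec_single, MulOpposite.op_one, one_smul, single_dotProduct, col_apply, one_mul,
      Z_symm, dotProduct_single, mul_one] at modulus
    have entry : (1 + Yᵀ * Y) i j = (Pi.single i 1 : ι → ℝ) j + Y.col i ⬝ᵥ Y.col j := by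
      rw [Matrix.add_apply, one_eq_pi_single]
      rfl
    linarith

theorem shearMatrix_one_mul_transpose [DecidableEq ι] {Y : Matrix ι ι ℝ} (hY : Yᵀ = Y) :
    shearMatrix 1 Y * (shearMatrix 1 Y)ᵀ = fromBlocks 1 Y Yᵀ (1 + Yᵀ * Y) := by
  simp only [shearMatrix, fromBlocks_transpose, fromBlocks_multiply, hY, inv_one, Matrix.mul_one,
    Matrix.one_mul, transpose_one, transpose_zero, Matrix.mul_zero, add_zero, add_comm (Y * Y)]

theorem shearMatrix_zero_conj [DecidableEq ι] {A Y Z : Matrix ι ι ℝ} (hA : IsUnit A.det)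
    (hAs : Aᵀ = A) :
    shearMatrix A 0 * fromBlocks (A * A) Y Yᵀ Z * (shearMatrix A 0)ᵀ =
      fromBlocks 1 (A⁻¹ * Y * A) (A⁻¹ * Y * A)ᵀ (A * Z * A) := by
  simp only [shearMatrix, fromBlocks_transpose, fromBlocks_multiply, transpose_mul,
    transpose_nonsing_inv, hAs, transpose_zero, Matrix.zero_mul, Matrix.mul_zero, add_zero,
    zero_add, Matrix.mul_assoc, nonsing_inv_mul_cancel_left _ _ hA, mul_nonsing_inv _ hA]

theorem HasGaussianChar.exists_eq_mul_transpose [DecidableEq ι] {ψ : ModeSpace ι}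
    {V : PhaseMatrix ι} (h : HasGaussianChar ψ V 0) (hV : Vᵀ = V) :
    ∃ T ∈ symplecticGroup ι ℝ, V = T * Tᵀ := by
  have posDef := h.posDef hV
  obtain ⟨X, Y, Y', Z, rfl⟩ : ∃ X Y Y' Z, V = fromBlocks X Y Y' Z :=
    ⟨_, _, _, _, (fromBlocks_toBlocks V).symm⟩
  have hX : X.PosDef := posDef.submatrix Sum.inl_injective
  rw [fromBlocks_transpose, fromBlocks_inj] at hV
  obtain ⟨-, -, rfl, hZ⟩ := hV
  obtain ⟨A, -, hAs, rfl⟩ := (isBlockDiagonal_const () X).exists_sqrt hX.posSemidef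
  have hA : IsUnit A.det :=
    (isUnit_iff_isUnit_det A).1 (isUnit_of_mul_isUnit_left hX.isUnit)
  have hN := shearMatrix_mem_symplecticGroup hA transpose_zero
  have hNdet := SymplecticGroup.symplectic_det hN
  set N := shearMatrix A 0
  set Y₁ := A⁻¹ * Y * A
  have normal_form : N * fromBlocks (A * A) Y Yᵀ Z * Nᵀ = fromBlocks 1 Y₁ Y₁ᵀ (A * Z * A) :=
    shearMatrix_zero_conj hA hAs
  obtain ⟨hY₁, hZ₁⟩ := HasGaussianChar.transpose_eq_and_eq_one_add
    (normal_form ▸ h.map (implements_shearUnitary hA transpose_zero))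
    (by simp only [transpose_mul, hAs, hZ, Matrix.mul_assoc])
  rw [hZ₁, ← shearMatrix_one_mul_transpose hY₁] at normal_form
  refine ⟨N⁻¹ * shearMatrix 1 Y₁, mul_mem (inv_mem_symplecticGroup hN)
    (shearMatrix_mem_symplecticGroup (by simp) hY₁), ?_⟩
  calc fromBlocks (A * A) Y Yᵀ Z = N⁻¹ * (N * fromBlocks (A * A) Y Yᵀ Z * Nᵀ) * (N⁻¹)ᵀ := by
        rw [transpose_nonsing_inv, Matrix.mul_assoc N, nonsing_inv_mul_cancel_left _ _ hNdet,
          mul_nonsing_inv_cancel_right _ _ (by rwa [det_transpose])]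
    _ = N⁻¹ * shearMatrix 1 Y₁ * (N⁻¹ * shearMatrix 1 Y₁)ᵀ := by
        rw [normal_form, transpose_mul]
        simp only [Matrix.mul_assoc]

theorem vacuumFun_add_mul_vacuumFun [DecidableEq ι] (b : ι → ℝ) (x : Config ι) :
    ((vacuumFun (x + WithLp.toLp 2 b) * vacuumFun x : ℝ) : ℂ) = gaussKernel 0 1 b x := by
  rw [gaussKernel_eq_ofReal_mul_exp, vacuumFun_mul, norm_sq_eq_dotProduct, norm_sq_eq_dotProduct]
  simp only [zero_mulVec, one_mulVec, zero_dotProduct, Complex.ofReal_zero, mul_zero,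
    Complex.exp_zero, mul_one, WithLp.ofLp_add, dotProduct_add, add_dotProduct, smul_dotProduct,
    dotProduct_smul, smul_eq_mul, dotProduct_comm b x.ofLp, add_zero]
  ring_nf

theorem HasGaussianChar.ae_ae_mul_conj_eq [DecidableEq ι] {φ : ModeSpace ι}
    (h : HasGaussianChar φ 1 0) : ∀ᵐ x : Config ι, ∀ᵐ b : Config ι,
      φ (x + b) * starRingEnd ℂ (φ x) = ((vacuumFun (x + b) * vacuumFun x : ℝ) : ℂ) := by
  have measurable_φ : Measurable (φ : Config ι → ℂ) := (Lp.stronglyMeasurable φ).measurable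
  have measurable_vacuumFun : Measurable (vacuumFun (ι := ι)) := by
    unfold vacuumFun
    fun_prop
  refine (Measure.ae_ae_comm ?_).1 (.of_forall fun b => ?_)
  · exact measurableSet_eq_fun (by fun_prop) (by fun_prop)
  · have h' : HasGaussianChar φ (fromBlocks 1 0 (0 : Matrix ι ι ℝ)ᵀ 1) 0 := by
      rwa [transpose_zero, fromBlocks_one]
    filter_upwards [h'.ae_eq_gaussKernel b.ofLp] with x hx
    rw [hx, ← vacuumFun_add_mul_vacuumFun]

theorem HasGaussianChar.eq_smul_vacuum [DecidableEq ι] {φ : ModeSpace ι}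
    (h : HasGaussianChar φ 1 0) : ∃ c : ℂ, ‖c‖ = 1 ∧ φ = c • vacuum ι := by
  obtain ⟨x₀, hx₀⟩ := h.ae_ae_mul_conj_eq.exists
  have hne : starRingEnd ℂ (φ x₀) ≠ 0 := by
    intro hzero
    obtain ⟨b, hb⟩ := hx₀.exists
    rw [hzero, mul_zero, eq_comm, Complex.ofReal_eq_zero] at hb
    exact (mul_pos (vacuumFun_pos (x₀ + b)) (vacuumFun_pos x₀)).ne' hb
  obtain ⟨c, hc⟩ : ∃ c : ℂ, φ = c • vacuum ι := by
    refine ⟨vacuumFun x₀ / starRingEnd ℂ (φ x₀), Lp.ext ?_⟩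
    filter_upwards [ae_comp_add_right hx₀ (-x₀), Lp.coeFn_smul (_ : ℂ) (vacuum ι),
      coeFn_vacuum (ι := ι)] with y hy h_smul h_vacuum
    rw [add_comm y, add_neg_cancel_left, Complex.ofReal_mul] at hy
    rw [h_smul, Pi.smul_apply, h_vacuum, smul_eq_mul, div_mul_eq_mul_div, eq_div_iff hne, hy,
      mul_comm]
  refine ⟨c, ?_, hc⟩
  rw [← h.norm_eq_one, hc, norm_smul, norm_vacuum, mul_one]

end Purity

/-! ### Ergotropic gaps as differences of least traces -/

section TensorChar

variable {ι ι' : Type} [Fintype ι] [Fintype ι']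

theorem weylFun_tensorFun (ξ : (ι ⊕ ι') ⊕ (ι ⊕ ι') → ℝ) (f : Config ι → ℂ) (f' : Config ι' → ℂ)
    (x : Config (ι ⊕ ι')) :
    weylFun ξ (tensorFun f f') x =
      weylFun (ξ ∘ Sum.map Sum.inl Sum.inl) f (WithLp.toLp 2 fun i => x (Sum.inl i)) *
        weylFun (ξ ∘ Sum.map Sum.inr Sum.inr) f' (WithLp.toLp 2 fun i => x (Sum.inr i)) := by
  simp only [weylFun, tensorFun, Fintype.sum_sum_type, Function.comp_apply, Sum.map_inl,
    Sum.map_inr]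
  rw [mul_mul_mul_comm, ← Complex.exp_add]
  congr 2
  push_cast
  ring

theorem inner_weyl_tensor (ξ : (ι ⊕ ι') ⊕ (ι ⊕ ι') → ℝ) (ψ : ModeSpace ι) (ψ' : ModeSpace ι') :
    inner ℂ (tensor ψ ψ') (weyl ξ (tensor ψ ψ')) =
      inner ℂ ψ (weyl (ξ ∘ Sum.map Sum.inl Sum.inl) ψ) *
        inner ℂ ψ' (weyl (ξ ∘ Sum.map Sum.inr Sum.inr) ψ') := by
  let F (x : Config ι) : ℂ := weylFun (ξ ∘ Sum.map Sum.inl Sum.inl) ψ x * starRingEnd ℂ (ψ x)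
  let F' (x : Config ι') : ℂ := weylFun (ξ ∘ Sum.map Sum.inr Sum.inr) ψ' x * starRingEnd ℂ (ψ' x)
  have measurable_F : AEStronglyMeasurable F volume :=
    (memLp_weylFun _ ψ).1.mul (Complex.continuous_conj.comp_aestronglyMeasurable (Lp.memLp ψ).1)
  have measurable_F' : AEStronglyMeasurable F' volume :=
    (memLp_weylFun _ ψ').1.mul (Complex.continuous_conj.comp_aestronglyMeasurable (Lp.memLp ψ').1)
  have coeFn_tensor := (memLp_tensorFun ψ ψ').coeFn_toLp
  have integrand : (fun x => weylFun ξ (tensor ψ ψ') x * starRingEnd ℂ (tensor ψ ψ' x)) =ᵐ[volume]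
      fun x : Config (ι ⊕ ι') => F (WithLp.toLp 2 fun i => x (Sum.inl i)) *
        F' (WithLp.toLp 2 fun i => x (Sum.inr i)) := by
    filter_upwards [coeFn_tensor, weylFun_congr_ae coeFn_tensor ξ] with x h₁ h₂
    rw [tensor, h₁, h₂, weylFun_tensorFun]
    simp only [F, F', tensorFun, map_mul]
    ring
  rw [inner_weyl, inner_weyl, inner_weyl, integral_congr_ae integrand, ← integral_prod_mul F F',
    ← (measurePreserving_split (ι := ι) (ι' := ι')).map_eq, integral_map]
  · exact measurePreserving_split.measurable.aemeasurable
  · rw [measurePreserving_split.map_eq]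
    exact measurable_F.comp_fst.mul measurable_F'.comp_snd

theorem dotProduct_phaseSum_mulVec (V : PhaseMatrix ι) (V' : PhaseMatrix ι')
    (ξ : (ι ⊕ ι') ⊕ (ι ⊕ ι') → ℝ) :
    ξ ⬝ᵥ phaseSum V V' *ᵥ ξ =
      (ξ ∘ Sum.map Sum.inl Sum.inl) ⬝ᵥ V *ᵥ (ξ ∘ Sum.map Sum.inl Sum.inl) +
        (ξ ∘ Sum.map Sum.inr Sum.inr) ⬝ᵥ V' *ᵥ (ξ ∘ Sum.map Sum.inr Sum.inr) := by
  have regroup : ξ ∘ (Equiv.sumSumSumComm ι ι' ι ι').symm =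
      Sum.elim (ξ ∘ Sum.map Sum.inl Sum.inl) (ξ ∘ Sum.map Sum.inr Sum.inr) := by
    ext ((_ | _) | (_ | _)) <;> rfl
  rw [phaseSum, submatrix_mulVec_equiv, ← comp_equiv_symm_dotProduct, regroup, fromBlocks_mulVec,
    Sum.elim_comp_inl, Sum.elim_comp_inr, zero_mulVec, zero_mulVec, add_zero, zero_add,
    sumElim_dotProduct_sumElim]

theorem HasGaussianChar.tensor {ψ : ModeSpace ι} {ψ' : ModeSpace ι'} {V : PhaseMatrix ι}
    {V' : PhaseMatrix ι'} (h : HasGaussianChar ψ V 0) (h' : HasGaussianChar ψ' V' 0) :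
    HasGaussianChar (_root_.tensor ψ ψ') (phaseSum V V') 0 := by
  rw [hasGaussianChar_zero_iff] at h h' ⊢
  intro ξ
  rw [inner_weyl_tensor, h, h', dotProduct_phaseSum_mulVec, mul_add, Real.exp_add,
    Complex.ofReal_mul]

end TensorChar

section GapFormula

variable {ι : Type} [Fintype ι] {k : ℕ} {P : ι → Fin k} {ψ : ModeSpace ι} {V : PhaseMatrix ι}

theorem HasGaussianChar.energy_map (h : HasGaussianChar ψ V 0) (hV : V.PosSemidef)
    {U : ModeSpace ι ≃ₗᵢ[ℂ] ModeSpace ι} {S : PhaseMatrix ι} {d : ι ⊕ ι → ℝ}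
    (hU : Implements U S d) :
    energy (U ψ) = ENNReal.ofReal ((S * V * Sᵀ).trace / 4 + d ⬝ᵥ d / 2) :=
  (h.map hU).energy_eq fun _ => (posSemidef_mul_mul_transpose hV S).diag_nonneg

variable [DecidableEq ι]

theorem HasGaussianChar.iInf_energy_eq {α : Type*} (h : HasGaussianChar ψ V 0) (hV : V.PosDef)
    {c : ι → α} {C : (ModeSpace ι ≃ₗᵢ[ℂ] ModeSpace ι) → Prop}
    (implements : ∀ U, C U → ∃ S ∈ localSymplecticGroup c, ∃ d, Implements U S d)
    (shear : ∀ {A Q : Matrix ι ι ℝ} (hA : IsUnit A.det), Qᵀ = Q → IsBlockDiagonal c A →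
      IsBlockDiagonal c Q → C (shearUnitary hA Q)) :
    ⨅ (U : ModeSpace ι ≃ₗᵢ[ℂ] ModeSpace ι) (_ : C U), energy (U ψ) =
      ENNReal.ofReal (minTrace c V / 4) := by
  apply le_antisymm
  · obtain ⟨S, hS, hmin⟩ := exists_trace_eq_minTrace c hV
    obtain ⟨A, Q, hA, hQ, hAc, hQc, hS'⟩ := exists_shearMatrix hS
    refine (iInf₂_le (shearUnitary hA Q) (shear hA hQ hAc hQc)).trans_eq ?_
    rw [h.energy_map hV.posSemidef (implements_shearUnitary hA hQ), trace_mul_mul_transpose, hS',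
      ← trace_mul_mul_transpose, hmin, dotProduct_zero, zero_div, add_zero]
  · refine le_iInf₂ fun U hU => ?_
    obtain ⟨S, hS, d, hd⟩ := implements U hU
    rw [h.energy_map hV.posSemidef hd]
    apply ENNReal.ofReal_le_ofReal
    have trace_le := minTrace_le hV.posSemidef hS
    have displacement : 0 ≤ d ⬝ᵥ d := Finset.sum_nonneg fun i _ => mul_self_nonneg (d i)
    linarith

theorem minTrace_nonneg {α : Type*} (c : ι → α) (hV : V.PosSemidef) : 0 ≤ minTrace c V :=
  Real.iInf_nonneg fun S => (posSemidef_mul_mul_transpose hV S.1).trace_nonneg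

theorem HasGaussianChar.ergotropicGap_eq (h : HasGaussianChar ψ V 0) (hV : V.PosDef) :
    ergotropicGap P ψ = (minTrace P V - minTrace (fun _ => ()) V) / 4 := by
  have local_energy : ⨅ (U : ModeSpace ι ≃ₗᵢ[ℂ] ModeSpace ι) (_ : IsLocalGaussianUnitary P U),
      energy (U ψ) = ENNReal.ofReal (minTrace P V / 4) :=
    h.iInf_energy_eq hV (fun _ hU => hU.exists_implements) isLocalGaussianUnitary_shearUnitary
  have global_energy : ⨅ (U : ModeSpace ι ≃ₗᵢ[ℂ] ModeSpace ι) (_ : IsGaussianUnitary U),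
      energy (U ψ) = ENNReal.ofReal (minTrace (fun _ => ()) V / 4) :=
    h.iInf_energy_eq hV (fun _ ⟨S, hS, hU⟩ => ⟨S, mem_localSymplecticGroup_const.2 hS, hU⟩)
      fun hA hQ _ _ => isGaussianUnitary_shearUnitary hA hQ
  have local_nonneg := minTrace_nonneg P hV.posSemidef
  have global_nonneg := minTrace_nonneg (fun _ => ()) hV.posSemidef
  rw [ergotropicGap, globalErgotropy, localErgotropy, local_energy, global_energy,
    ENNReal.toReal_ofReal (by positivity), ENNReal.toReal_ofReal (by positivity)]
  ring

theorem minTrace_const_le {α β : Type*} (a : β) (c : ι → α) (hV : V.PosDef) :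
    minTrace (fun _ => a) V ≤ minTrace c V := by
  obtain ⟨S, hS, hmin⟩ := exists_trace_eq_minTrace c hV
  exact (minTrace_le hV.posSemidef (mem_localSymplecticGroup_const.2 hS.1)).trans_eq hmin

theorem ergotropicGap_nonneg (h : IsPureGaussian ψ) : 0 ≤ ergotropicGap P ψ := by
  obtain ⟨V, hVs, h⟩ := h
  rw [← hasGaussianChar_zero_iff] at h
  have hV := h.posDef hVs
  rw [h.ergotropicGap_eq hV]
  exact div_nonneg (sub_nonneg.2 (minTrace_const_le () P hV)) zero_le_four

theorem ergotropicGap_tensor {ι' : Type} [Fintype ι'] [DecidableEq ι'] {ψ' : ModeSpace ι'}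
    (h : IsPureGaussian ψ) (h' : IsPureGaussian ψ') (P : ι → Fin k) (P' : ι' → Fin k) :
    ergotropicGap (Sum.elim P P') (tensor ψ ψ') = ergotropicGap P ψ + ergotropicGap P' ψ' := by
  obtain ⟨V, hVs, h⟩ := h
  obtain ⟨V', hVs', h'⟩ := h'
  rw [← hasGaussianChar_zero_iff] at h h'
  have hV := h.posDef hVs
  have hV' := h'.posDef hVs'
  have hVV' : (phaseSum V V').PosDef :=
    (h.tensor h').posDef (by rw [transpose_phaseSum, hVs, hVs'])
  have global_add := minTrace_phaseSum (c := fun _ => ()) (c' := fun _ => ()) hV hV'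
  rw [Sum.elim_lam_const_lam_const] at global_add
  rw [h.ergotropicGap_eq hV, h'.ergotropicGap_eq hV', (h.tensor h').ergotropicGap_eq hVV',
    minTrace_phaseSum hV hV', global_add]
  ring

end GapFormula

/-! ### Faithfulness -/

section Faithful

variable {ι : Type} [Fintype ι] {k : ℕ} {P : ι → Fin k} {ψ : ModeSpace ι} {V : PhaseMatrix ι}

theorem IsProductAcross.inner_weyl_add (hP : IsProductAcross P ψ) {ξ η : ι ⊕ ι → ℝ}
    (h : ∀ j, phasePart P ξ j = 0 ∨ phasePart P η j = 0) :
    inner ℂ ψ (weyl (ξ + η) ψ) = inner ℂ ψ (weyl ξ ψ) * inner ℂ ψ (weyl η ψ) := by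
  obtain ⟨φ, hφ, hψ⟩ := hP
  obtain rfl := isProductOf_iff.1 hψ
  have phasePart_add (j : Fin k) : phasePart P (ξ + η) j = phasePart P ξ j + phasePart P η j := rfl
  have inner_weyl_zero (j : Fin k) : inner ℂ (φ j) (weyl 0 (φ j)) = 1 := by
    rw [weyl_zero, inner_self_eq_norm_sq_to_K, hφ j, RCLike.ofReal_one, one_pow]
  simp only [weyl_productVec, inner_productVec, ← Finset.prod_mul_distrib]
  refine Finset.prod_congr rfl fun j _ => ?_
  rw [phasePart_add]
  rcases h j with hj | hj <;>
    simp only [hj, zero_add, add_zero, inner_weyl_zero, one_mul, mul_one]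

variable [DecidableEq ι]

omit [Fintype ι] in
theorem phasePart_single_of_ne {x : ι ⊕ ι} {j : Fin k} (hx : Sum.elim P P x ≠ j) :
    phasePart P (Pi.single x 1) j = 0 := by
  ext a
  refine Pi.single_eq_of_ne ?_ _
  rintro rfl
  rcases a with a | a <;> exact hx a.2

omit [DecidableEq ι] in
theorem HasGaussianChar.isBlockDiagonal_of_isProductAcross (h : HasGaussianChar ψ V 0)
    (hV : Vᵀ = V) (hP : IsProductAcross P ψ) : IsBlockDiagonal (Sum.elim P P) V := by
  classical
  intro x y hxy
  have char_add := hP.inner_weyl_add (ξ := Pi.single x 1) (η := Pi.single y 1) fun j =>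
    (not_and_or.1 fun ⟨hx, hy⟩ => hxy (hx.trans hy.symm)).imp
      phasePart_single_of_ne phasePart_single_of_ne
  rw [hasGaussianChar_zero_iff] at h
  rw [h, h, h, ← Complex.ofReal_mul, ← Real.exp_add] at char_add
  have exponent_add := Real.exp_injective (Complex.ofReal_injective char_add)
  simp only [mulVec_add, dotProduct_add, add_dotProduct, single_one_dotProduct, mulVec_single_one,
    col_apply] at exponent_add
  have symm : V y x = V x y := congrFun (congrFun hV x) y
  linarith

theorem minTrace_const_eq_of_isBlockDiagonal {α β : Type*} {c : ι → α} (a : β) (hV : V.PosDef)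
    (hc : IsBlockDiagonal (Sum.elim c c) V) : minTrace (fun _ => a) V = minTrace c V := by
  classical
  obtain ⟨S, hS, hmin⟩ := exists_trace_eq_minTrace c hV
  have comm := (trace_eq_minTrace_iff hV.posSemidef hS).1 hmin
  rw [((hS.2.mul hc).mul hS.2.transpose).pinch_eq] at comm
  have hS' : S ∈ localSymplecticGroup fun _ => a := mem_localSymplecticGroup_const.2 hS.1
  rw [← hmin, ← trace_eq_minTrace_of_commute hV.posSemidef hS']
  rwa [Sum.elim_lam_const_lam_const, (isBlockDiagonal_const a _).pinch_eq]

theorem eq_one_of_posDef_of_commute_J {W : PhaseMatrix ι} (hW : W.PosDef)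
    (hS : W ∈ symplecticGroup ι ℝ) (hJ : Commute W (J ι ℝ)) : W = 1 := by
  have symplectic : W * J ι ℝ * W = J ι ℝ := by
    simpa only [isHermitian_iff_isSymm.1 hW.isHermitian |>.eq] using SymplecticGroup.mem_iff.1 hS
  have involutive : W * W = 1 := by
    refine ((isUnit_iff_isUnit_det _).2 (isUnit_det_J ι ℝ)).mul_left_cancel ?_
    rw [mul_one, ← mul_assoc, ← hJ.eq, symplectic]
  refine sub_eq_zero.1 ((hW.add PosDef.one).isUnit.mul_left_cancel ?_)
  rw [mul_zero, add_mul, mul_sub, one_mul, involutive, mul_one, sub_add_sub_cancel', sub_self]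

theorem exists_conj_eq_one_of_minTrace_eq {α : Type*} {c : ι → α} {T : PhaseMatrix ι}
    (hT : T ∈ symplecticGroup ι ℝ)
    (hmin : minTrace c (T * Tᵀ) = minTrace (fun _ => ()) (T * Tᵀ)) :
    ∃ S ∈ localSymplecticGroup c, S * (T * Tᵀ) * Sᵀ = 1 := by
  have posDef {R : PhaseMatrix ι} (hR : R ∈ symplecticGroup ι ℝ) : (R * Rᵀ).PosDef := by
    simpa only [conjTranspose_eq_transpose_of_trivial] using PosDef.mul_conjTranspose_self R
      (vecMul_injective_of_isUnit
        ((isUnit_iff_isUnit_det R).2 (SymplecticGroup.symplectic_det hR)))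
  obtain ⟨S, hS, hSmin⟩ := exists_trace_eq_minTrace c (posDef hT)
  have hS' : S ∈ localSymplecticGroup fun _ => () := mem_localSymplecticGroup_const.2 hS.1
  have comm := (trace_eq_minTrace_iff (posDef hT).posSemidef hS').1 (hSmin.trans hmin)
  rw [Sum.elim_lam_const_lam_const, (isBlockDiagonal_const () _).pinch_eq] at comm
  have hST := mul_mem hS.1 hT
  have conj_eq : S * (T * Tᵀ) * Sᵀ = S * T * (S * T)ᵀ := by
    rw [transpose_mul]
    simp only [Matrix.mul_assoc]
  refine ⟨S, hS, ?_⟩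
  rw [conj_eq] at comm ⊢
  exact eq_one_of_posDef_of_commute_J (posDef hST)
    (mul_mem hST (SymplecticGroup.transpose_mem hST)) comm

theorem conj_eq_one_congr {S T : PhaseMatrix ι} (h : Tᵀ * T = Sᵀ * S) (hS : S * V * Sᵀ = 1) :
    T * V * Tᵀ = 1 := by
  -- `R V Rᵀ = 1` says that `RᵀR` inverts `V`
  rw [Matrix.mul_assoc, mul_eq_one_comm, Matrix.mul_assoc] at hS ⊢
  rwa [h]

theorem HasGaussianChar.exists_isLocalGaussianUnitary_apply_eq (h : HasGaussianChar ψ V 0)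
    (hV : Vᵀ = V) (hgap : ergotropicGap P ψ = 0) :
    ∃ U, IsLocalGaussianUnitary P U ∧ ∃ c : ℂ, ‖c‖ = 1 ∧ U ψ = c • vacuum ι := by
  have minTrace_eq : minTrace P V = minTrace (fun _ => ()) V := by
    rw [h.ergotropicGap_eq (h.posDef hV)] at hgap
    linarith
  obtain ⟨T, hT, rfl⟩ := h.exists_eq_mul_transpose hV
  obtain ⟨S, hS, hone⟩ := exists_conj_eq_one_of_minTrace_eq hT minTrace_eq
  obtain ⟨A, Q, hA, hQ, hAP, hQP, hS'⟩ := exists_shearMatrix hS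
  have hchar := h.map (implements_shearUnitary hA hQ)
  rw [conj_eq_one_congr hS' hone] at hchar
  exact ⟨shearUnitary hA Q, isLocalGaussianUnitary_shearUnitary hA hQ hAP hQP,
    hchar.eq_smul_vacuum⟩

theorem IsLocalGaussianUnitary.isProductAcross_symm_vacuum {U : ModeSpace ι ≃ₗᵢ[ℂ] ModeSpace ι}
    (hU : IsLocalGaussianUnitary P U) : IsProductAcross P (U.symm (vacuum ι)) := by
  obtain ⟨u, -, hu⟩ := hU
  refine ⟨fun j => (u j).symm (vacuum (ModesOf P j)), fun j => ?_, ?_⟩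
  · rw [LinearIsometryEquiv.norm_map, norm_vacuum]
  · obtain ⟨Ψ, hΨ, hUΨ⟩ := hu fun j => (u j).symm (vacuum (ModesOf P j))
    simp only [LinearIsometryEquiv.apply_symm_apply] at hUΨ
    rw [isProductOf_iff, productVec_vacuum] at hUΨ
    rwa [← hUΨ, LinearIsometryEquiv.symm_apply_apply]

omit [DecidableEq ι] in
theorem IsProductAcross.smul (hk : 1 ≤ k) (h : IsProductAcross P ψ) {c : ℂ} (hc : ‖c‖ = 1) :
    IsProductAcross P (c • ψ) := by
  obtain ⟨φ, hφ, hψ⟩ := h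
  rw [isProductOf_iff] at hψ
  let j₀ : Fin k := ⟨0, hk⟩
  refine ⟨fun j => Pi.mulSingle (M := fun _ => ℂ) j₀ c j • φ j, fun j => ?_, ?_⟩
  · rw [norm_smul, hφ j, mul_one]
    obtain rfl | hj := eq_or_ne j j₀
    · rw [Pi.mulSingle_eq_same, hc]
    · rw [Pi.mulSingle_eq_of_ne hj, norm_one]
  · rw [isProductOf_iff, productVec_smul, Fintype.prod_pi_mulSingle', hψ]

theorem ergotropicGap_eq_zero_iff (hk : 1 ≤ k) (h : IsPureGaussian ψ) :
    ergotropicGap P ψ = 0 ↔ IsProductAcross P ψ := by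
  obtain ⟨V, hV, h⟩ := h
  rw [← hasGaussianChar_zero_iff] at h
  constructor
  · intro hgap
    obtain ⟨U, hU, c, hc, hUψ⟩ := h.exists_isLocalGaussianUnitary_apply_eq hV hgap
    rw [← U.symm_apply_apply ψ, hUψ, map_smul]
    exact hU.isProductAcross_symm_vacuum.smul hk hc
  · intro hP
    rw [h.ergotropicGap_eq (h.posDef hV), minTrace_const_eq_of_isBlockDiagonal () (h.posDef hV)
      (h.isBlockDiagonal_of_isProductAcross hV hP), sub_self, zero_div]

end Faithful

/-! ### Scores -/

section Score

variable {ι ι' : Type} {k : ℕ}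

theorem pooledPartitions_subset_kPartitions :
    pooledPartitions ι ι' k ⊆ kPartitions (ι ⊕ ι') k := by
  rintro _ ⟨P, hP, P', -, rfl⟩
  exact Function.Surjective.of_comp (g := Sum.inl) hP

variable [Fintype ι] [Fintype ι']

theorem kPartitions_nonempty (hk : 1 ≤ k) (hι : k ≤ Fintype.card ι) :
    (kPartitions ι k).Nonempty := by
  have : Nonempty (Fin k) := ⟨⟨0, hk⟩⟩
  obtain ⟨f⟩ := Function.Embedding.nonempty_of_card_le ((Fintype.card_fin k).trans_le hι)
  exact ⟨_, Function.invFun_surjective f.injective⟩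

variable [DecidableEq ι] [DecidableEq ι'] {ψ : ModeSpace ι} {ψ' : ModeSpace ι'}

theorem isLeast_minGap {C : Set (ι → Fin k)} (hC : C.Nonempty) (ψ : ModeSpace ι) :
    IsLeast ((fun P => ergotropicGap P ψ) '' C) (minGap C ψ) :=
  ((C.toFinite.image _).isCompact).isLeast_sInf (hC.image _)

theorem minGap_anti {C D : Set (ι → Fin k)} (hC : C.Nonempty) (h : C ⊆ D) (ψ : ModeSpace ι) :
    minGap D ψ ≤ minGap C ψ :=
  (isLeast_minGap hC ψ).mono (isLeast_minGap (hC.mono h) ψ) (Set.image_mono h)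

theorem ergotropicScore_eq_zero_iff (hk : 1 ≤ k) (hι : k ≤ Fintype.card ι)
    (h : IsPureGaussian ψ) :
    ergotropicScore k ψ = 0 ↔ ∃ P ∈ kPartitions ι k, IsProductAcross P ψ := by
  simp only [← ergotropicGap_eq_zero_iff hk h]
  obtain ⟨⟨P, hP, attained⟩, lower⟩ := isLeast_minGap (kPartitions_nonempty hk hι) ψ
  constructor
  · intro hzero
    exact ⟨P, hP, attained.trans hzero⟩
  · rintro ⟨R, hR, hzero⟩
    refine le_antisymm ((lower ⟨R, hR, rfl⟩).trans_eq hzero) ?_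
    exact (ergotropicGap_nonneg h).trans_eq attained

theorem pooledErgotropicScore_tensor (hk : 1 ≤ k) (hι : k ≤ Fintype.card ι)
    (hι' : k ≤ Fintype.card ι') (h : IsPureGaussian ψ) (h' : IsPureGaussian ψ') :
    pooledErgotropicScore k (tensor ψ ψ') = ergotropicScore k ψ + ergotropicScore k ψ' := by
  obtain ⟨⟨P, hP, attained⟩, lower⟩ := isLeast_minGap (kPartitions_nonempty hk hι) ψ
  obtain ⟨⟨P', hP', attained'⟩, lower'⟩ := isLeast_minGap (kPartitions_nonempty hk hι') ψ'
  refine IsLeast.csInf_eq ⟨⟨Sum.elim P P', ⟨P, hP, P', hP', rfl⟩, ?_⟩, ?_⟩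
  · exact (ergotropicGap_tensor h h' P P').trans (congrArg₂ _ attained attained')
  · rintro _ ⟨_, ⟨R, hR, R', hR', rfl⟩, rfl⟩
    exact (add_le_add (lower ⟨R, hR, rfl⟩) (lower' ⟨R', hR', rfl⟩)).trans_eq
      (ergotropicGap_tensor h h' R R').symm

theorem ergotropicScore_tensor_le (hk : 1 ≤ k) (hι : k ≤ Fintype.card ι)
    (hι' : k ≤ Fintype.card ι') (h : IsPureGaussian ψ) (h' : IsPureGaussian ψ') :
    ergotropicScore k (tensor ψ ψ') ≤ ergotropicScore k ψ + ergotropicScore k ψ' := by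
  rw [← pooledErgotropicScore_tensor hk hι hι' h h']
  obtain ⟨P, hP⟩ := kPartitions_nonempty hk hι
  obtain ⟨P', hP'⟩ := kPartitions_nonempty hk hι'
  exact minGap_anti (C := pooledPartitions ι ι' k) ⟨_, P, hP, P', hP', rfl⟩
    pooledPartitions_subset_kPartitions _

end Score

theorem corollary4_general {k : ℕ} (hk : 1 ≤ k) :
    (∀ (ι : Type) [Fintype ι] [DecidableEq ι], k ≤ Fintype.card ι →
      ∀ ψ : ModeSpace ι, IsPureGaussian ψ →
        (ergotropicScore k ψ = 0 ↔ ∃ P ∈ kPartitions ι k, IsProductAcross P ψ)) ∧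
    (∀ (ι ι' : Type) [Fintype ι] [DecidableEq ι] [Fintype ι'] [DecidableEq ι'],
      k ≤ Fintype.card ι → k ≤ Fintype.card ι' →
      ∀ (ψ : ModeSpace ι) (ψ' : ModeSpace ι'), IsPureGaussian ψ → IsPureGaussian ψ' →
        (∀ (P : ι → Fin k) (P' : ι' → Fin k),
          ergotropicGap (Sum.elim P P') (tensor ψ ψ') =
            ergotropicGap P ψ + ergotropicGap P' ψ') ∧
        pooledErgotropicScore k (tensor ψ ψ') = ergotropicScore k ψ + ergotropicScore k ψ' ∧
        ergotropicScore k (tensor ψ ψ') ≤ ergotropicScore k ψ + ergotropicScore k ψ') :=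
  ⟨fun _ _ _ hι _ h => ergotropicScore_eq_zero_iff hk hι h,
    fun _ _ _ _ _ _ hι hι' _ _ h h' => ⟨ergotropicGap_tensor h h',
      pooledErgotropicScore_tensor hk hι hι' h h', ergotropicScore_tensor_le hk hι hι' h h'⟩⟩

end

theorem corollary4 (k : ℕ) (hk : 1 ≤ k) :
    -- faithfulness
    (∀ (N : ℕ) (_ : k ≤ N) (ψ : ModeSpace (Fin N)), IsPureGaussian ψ →
      (ergotropicScore k ψ = 0 ↔ ∃ P ∈ kPartitions (Fin N) k, IsProductAcross P ψ)) ∧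
    -- additivity
    (∀ (N N' : ℕ) (_ : k ≤ N) (_ : k ≤ N') (ψ : ModeSpace (Fin N)) (ψ' : ModeSpace (Fin N')),
      IsPureGaussian ψ → IsPureGaussian ψ' →
      (∀ P ∈ kPartitions (Fin N) k, ∀ P' ∈ kPartitions (Fin N') k,
        ergotropicGap (Sum.elim P P') (tensor ψ ψ') =
          ergotropicGap P ψ + ergotropicGap P' ψ') ∧
      pooledErgotropicScore k (tensor ψ ψ') = ergotropicScore k ψ + ergotropicScore k ψ' ∧
      ergotropicScore k (tensor ψ ψ') ≤ ergotropicScore k ψ + ergotropicScore k ψ') := by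
  refine ⟨fun N hN => (corollary4_general hk).1 _ (by simpa), fun N N' hN hN' ψ ψ' h h' => ?_⟩
  exact ((corollary4_general hk).2 _ _ (by simpa) (by simpa) ψ ψ' h h').imp_left
    fun gap P _ P' _ => gap P P'
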